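/- Let $\Lambda$ be a nonempty finite, strongly connected $k$-graph without sources: a countable small category with a degree functor $d:\Lambda\to\mathbb N^k$ such that every morphism $\lambda$ with $d(\lambda)=m+n$ factors uniquely as $\lambda=\mu\nu$ with $d(\mu)=m$, $d(\nu)=n$; such that $\Lambda^n=d^{-1}(n)$ is finite for every $n$; and such that $v\Lambda w\neq\emptyset$ for all vertices $v,w$. Let $A_i(v,w)=\#(v\Lambda^{e_i}w)$ be its adjacency matrices, $\rho_i$ the spectral radius of $A_i$, $\rho(\Lambda)^n=\prod_i\rho_i^{n_i}$, and $x^\Lambda$ the unique positive vector with $\sum_v x^\Lambda_v=1$ and $A_ix^\Lambda=\rho_ix^\Lambda$ for all $i$. Let $\Lambda^\infty$ be the space of infinite paths (degree-preserving functors $x:\Omega_k\to\Lambda$, where $\Omega_k$ has objects $\mathbb N^k$ and morphisms $(m,n)$, $m\le n$, of degree $n-m$), with the topology generated by the cylinder sets $[\eta]=\{x: x(0,d(\eta))=\eta\}$, let $\sigma^p(x)(m,n)=x(m+p,n+p)$ be the shift, and let $M$ be the unique Borel probability measure on $\Lambda^\infty$ with $M([\eta])=\rho(\Lambda)^{-d(\eta)}x^\Lambda_{s(\eta)}$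 for all $\eta\in\Lambda$. In the complex Hilbert space $L^2(\Lambda^\infty,M)$ put $$\mathscr V_n=\operatorname{span}\{\chi_{[\eta]}: d(\eta)=(n,\dots,n)\},\qquad \mathcal W_n=\mathscr V_{n+1}\cap\mathscr V_n^\perp,$$ let $\mathcal R_{-1}$ be the space of constant functions, and for $s\in\mathbb N$ let $$\mathcal R_s=\operatorname{span}\{\chi_{[\eta]}: \eta\in\Lambda,\ d(\eta)_i\le s\ \text{for all } i\}.$$ Let $\Xi_s$ be the orthogonal projection onto $\mathcal R_s$, let $(\alpha_q)_{q\in\mathbb N}$ be a strictly increasing sequence of positive real numbers with $\alpha_q\to\infty$, and let $$D=\sum_{q\in\mathbb N}\alpha_q(\Xi_q-\Xi_{q-1})$$ be the Dirac operator, an unbounded operator on $L^2(\Lambda^\infty,M)$ whose domain is the set of $f$ for which the series converges. Then the eigenspaces of $D$ agree with the wavelet decomposition of $L^2(\Lambda^\infty,M)$. Precisely: 1. $L^2(\Lambda^\infty,M)=\mathscr V_0\oplus\bigoplus_{q=0}^\infty\mathcal W_q$ as an orthogonal Hilbert space direct sum, and $\mathcal W_q=\operatorname{span}\{S_\lambda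 f: d(\lambda)=(q,\dots,q),\ f\in\mathcal W_0\}$, where $(S_\lambda f)(x)=\chi_{[\lambda]}(x)\,\rho(\Lambda)^{d(\lambda)/2}f(\sigma^{d(\lambda)}(x))$. 2. $\mathscr V_0=\mathcal R_0=(\mathcal R_0\cap\mathcal R_{-1}^\perp)\oplus\mathcal R_{-1}$ (an orthogonal direct sum), and $\mathcal W_q=\mathcal R_{q+1}\cap\mathcal R_q^\perp$ for all $q\ge 0$. 3. $\ker D=\mathcal R_{-1}$, $\ker(D-\alpha_0)=\mathcal R_0\cap\mathcal R_{-1}^\perp$, $\ker(D-\alpha_{q+1})=\mathcal W_q$ for all $q\ge0$, and $\ker(D-z)=0$ for every other $z\in\mathbb C$. -/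

import Mathlib

open MeasureTheory Filter Topology
open scoped ENNReal

/-- A `k`-graph, in the arrows-only picture: a countable small category with objects `Vertex` and
morphisms `Path` (`comp μ ν` is the product `μν`, defined when `source μ = range ν`), with a degree
functor to `ℕ^k` that has the factorization property. -/
structure KGraph (k : ℕ) where
  Vertex : Type*
  Path : Type*
  countable_path : Countable Path
  range : Path → Vertex
  source : Path → Vertex
  one : Vertex → Path
  comp : ∀ μ ν : Path, source μ = range ν → Path
  range_one : ∀ v, range (one v) = v
  source_one : ∀ v, source (one v) = v
  range_comp : ∀ μ ν h, range (comp μ ν h) = range μ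
  source_comp : ∀ μ ν h, source (comp μ ν h) = source ν
  one_comp : ∀ μ, comp (one (range μ)) μ (source_one _) = μ
  comp_one : ∀ μ, comp μ (one (source μ)) (range_one _).symm = μ
  comp_assoc : ∀ μ ν η (h₁ : source μ = range ν) (h₂ : source ν = range η),
    comp (comp μ ν h₁) η ((source_comp μ ν h₁).trans h₂) =
      comp μ (comp ν η h₂) (h₁.trans (range_comp ν η h₂).symm)
  degree : Path → (Fin k → ℕ)
  degree_one : ∀ v, degree (one v) = 0
  degree_comp : ∀ μ ν h, degree (comp μ ν h) = degree μ + degree ν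
  factorization : ∀ (η : Path) (m n : Fin k → ℕ), degree η = m + n →
    ∃! p : Path × Path, degree p.1 = m ∧ degree p.2 = n ∧ ∃ h, comp p.1 p.2 h = η

namespace KGraph

variable {k : ℕ}

/-- `Λ` is finite: there are finitely many paths of each degree. -/
class IsFinite (Λ : KGraph k) : Prop where
  finite_degree : ∀ n : Fin k → ℕ, {η : Λ.Path | Λ.degree η = n}.Finite

/-- `Λ` is strongly connected: `vΛw` is nonempty for all vertices `v`, `w`. -/
def StronglyConnected (Λ : KGraph k) : Prop :=
  ∀ v w : Λ.Vertex, ∃ η : Λ.Path, Λ.range η = v ∧ Λ.source η = w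

theorem finite_vertex (Λ : KGraph k) [Λ.IsFinite] : Finite Λ.Vertex := by
  have hfin : Finite {η : Λ.Path | Λ.degree η = 0} := (IsFinite.finite_degree 0).to_subtype
  refine Finite.of_injective
    (fun v : Λ.Vertex => (⟨Λ.one v, Λ.degree_one v⟩ : {η : Λ.Path | Λ.degree η = 0})) ?_
  intro v w h
  have h' : Λ.one v = Λ.one w := congrArg Subtype.val h
  rw [← Λ.range_one v, h', Λ.range_one]

noncomputable instance (Λ : KGraph k) [Λ.IsFinite] : Fintype Λ.Vertex :=
  haveI := Λ.finite_vertex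
  Fintype.ofFinite _

/-- The entries `A_i(v, w) = #(v Λ^{e_i} w)` of the `i`-th adjacency matrix. -/
noncomputable def adjacency (Λ : KGraph k) (i : Fin k) : Matrix Λ.Vertex Λ.Vertex ℕ :=
  fun v w => Nat.card
    {η : Λ.Path // Λ.degree η = Pi.single i 1 ∧ Λ.range η = v ∧ Λ.source η = w}

open Classical in
/-- `ρ_i`, the spectral radius of the `i`-th adjacency matrix. -/
noncomputable def rho (Λ : KGraph k) [Λ.IsFinite] (i : Fin k) : ℝ :=
  (spectralRadius ℂ ((Λ.adjacency i).map (fun n : ℕ => (n : ℂ)))).toReal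

/-- `ρ(Λ)^n = ρ_1^{n_1} ⋯ ρ_k^{n_k}`. -/
noncomputable def rhoPow (Λ : KGraph k) [Λ.IsFinite] (n : Fin k → ℕ) : ℝ :=
  ∏ i, Λ.rho i ^ n i

/-- `x` is a Perron-Frobenius eigenvector of `Λ`: it is positive, its entries sum to `1`, and
`A_i x = ρ_i x` for all `i`. -/
def IsPerronFrobenius (Λ : KGraph k) [Λ.IsFinite] (x : Λ.Vertex → ℝ) : Prop :=
  (∀ v, 0 < x v) ∧ ∑ v, x v = 1 ∧
    ∀ i, ((Λ.adjacency i).map (fun n : ℕ => (n : ℝ))).mulVec x = Λ.rho i • x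

open Classical in
/-- The Perron-Frobenius eigenvector `x^Λ` of `Λ` (it exists and is unique when `Λ` is finite,
strongly connected and nonempty). -/
noncomputable def perronVector (Λ : KGraph k) [Λ.IsFinite] : Λ.Vertex → ℝ :=
  if h : ∃ x, Λ.IsPerronFrobenius x then h.choose else 0

/-- An infinite path: a degree-preserving functor `Ω_k → Λ`. Here `obj m` is the image of the
object `m` and `seg m n` is the image `x(m, n)` of the morphism `(m, n)`, whose range is `m` and
whose source is `n`. -/
@[ext]
structure InfinitePath (Λ : KGraph k) where
  obj : (Fin k → ℕ) → Λ.Vertex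
  seg : ∀ m n : Fin k → ℕ, m ≤ n → Λ.Path
  range_seg : ∀ m n h, Λ.range (seg m n h) = obj m
  source_seg : ∀ m n h, Λ.source (seg m n h) = obj n
  seg_self : ∀ m, seg m m le_rfl = Λ.one (obj m)
  seg_comp : ∀ m n p (h₁ : m ≤ n) (h₂ : n ≤ p),
    Λ.comp (seg m n h₁) (seg n p h₂) ((source_seg m n h₁).trans (range_seg n p h₂).symm) =
      seg m p (h₁.trans h₂)
  degree_seg : ∀ m n h, Λ.degree (seg m n h) = n - m

/-- The shift `σ^p`, with `σ^p(x)(m, n) = x(m + p, n + p)`. -/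
def shift {Λ : KGraph k} (p : Fin k → ℕ) (x : Λ.InfinitePath) : Λ.InfinitePath where
  obj m := x.obj (m + p)
  seg m n h := x.seg (m + p) (n + p) (by gcongr)
  range_seg m n h := x.range_seg _ _ _
  source_seg m n h := x.source_seg _ _ _
  seg_self m := x.seg_self _
  seg_comp m n q h₁ h₂ := x.seg_comp _ _ _ _ _
  degree_seg m n h := by rw [x.degree_seg, add_tsub_add_eq_tsub_right]

/-- The cylinder set `[η] = {x : x(0, d(η)) = η}`. -/
def cylinder {Λ : KGraph k} (η : Λ.Path) : Set Λ.InfinitePath :=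
  {x | x.seg 0 (Λ.degree η) (fun _ => Nat.zero_le _) = η}

instance (Λ : KGraph k) : TopologicalSpace Λ.InfinitePath :=
  TopologicalSpace.generateFrom (Set.range fun η : Λ.Path => cylinder η)

instance (Λ : KGraph k) : MeasurableSpace Λ.InfinitePath := borel _

instance (Λ : KGraph k) : BorelSpace Λ.InfinitePath := ⟨rfl⟩

theorem measurableSet_cylinder {Λ : KGraph k} (η : Λ.Path) : MeasurableSet (cylinder η) :=
  (TopologicalSpace.isOpen_generateFrom_of_mem ⟨η, rfl⟩ : IsOpen (cylinder η)).measurableSet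

/-- `M` is a Borel probability measure on `Λ^∞` with `M([η]) = ρ(Λ)^{-d(η)} x^Λ_{s(η)}` for all
`η`. -/
def IsPathMeasure (Λ : KGraph k) [Λ.IsFinite] (M : Measure Λ.InfinitePath) : Prop :=
  IsProbabilityMeasure M ∧ ∀ η : Λ.Path,
    M (cylinder η) = ENNReal.ofReal ((Λ.rhoPow (Λ.degree η))⁻¹ * Λ.perronVector (Λ.source η))

open Classical in
/-- The measure `M` on `Λ^∞`: the unique Borel probability measure with
`M([η]) = ρ(Λ)^{-d(η)} x^Λ_{s(η)}` (it exists when `Λ` is finite, strongly connected, nonempty and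
has no sources). -/
noncomputable def pathMeasure (Λ : KGraph k) [Λ.IsFinite] : Measure Λ.InfinitePath :=
  if h : ∃ M, Λ.IsPathMeasure M then h.choose else 0

instance (Λ : KGraph k) [Λ.IsFinite] : IsFiniteMeasure Λ.pathMeasure := by
  unfold pathMeasure
  split_ifs with h
  · have := h.choose_spec.1
    infer_instance
  · infer_instance

/-- The complex Hilbert space `L²(Λ^∞, M)`. -/
abbrev L2 (Λ : KGraph k) [Λ.IsFinite] : Type _ := Lp ℂ 2 Λ.pathMeasure

/-- The characteristic function `χ_{[η]}` as an element of `L²(Λ^∞, M)`. -/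
noncomputable def chi (Λ : KGraph k) [Λ.IsFinite] (η : Λ.Path) : Λ.L2 :=
  indicatorConstLp 2 (measurableSet_cylinder η) (measure_ne_top _ _) (1 : ℂ)

/-! ### The wavelet decomposition -/

/-- `𝒱_n`, the span of the `χ_{[η]}` with `d(η) = (n, …, n)`. -/
noncomputable def scalingSpace (Λ : KGraph k) [Λ.IsFinite] (n : ℕ) : Submodule ℂ Λ.L2 :=
  Submodule.span ℂ (Λ.chi '' {η | Λ.degree η = fun _ => n})

/-- The wavelet space `𝒲_n = 𝒱_{n+1} ∩ 𝒱_n^⊥`. -/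
noncomputable def waveletSpace (Λ : KGraph k) [Λ.IsFinite] (n : ℕ) : Submodule ℂ Λ.L2 :=
  Λ.scalingSpace (n + 1) ⊓ (Λ.scalingSpace n)ᗮ

/-- The summands `𝒱_0, 𝒲_0, 𝒲_1, …` of the wavelet decomposition. -/
noncomputable def waveletSummand (Λ : KGraph k) [Λ.IsFinite] : ℕ → Submodule ℂ Λ.L2
  | 0 => Λ.scalingSpace 0
  | q + 1 => Λ.waveletSpace q

/-- `g = S_η f`, where `S_η` is the scaling and translation operator
`(S_η f)(x) = χ_{[η]}(x) ρ(Λ)^{d(η)/2} f(σ^{d(η)}(x))`. -/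
def IsTranslate (Λ : KGraph k) [Λ.IsFinite] (η : Λ.Path) (f g : Λ.L2) : Prop :=
  g =ᵐ[Λ.pathMeasure] (cylinder η).indicator
    fun x => (Real.sqrt (Λ.rhoPow (Λ.degree η)) : ℂ) * f (shift (Λ.degree η) x)

/-! ### The Dirac operator -/

/-- `ℛ_{-1}`, the constant functions. -/
noncomputable def constSpace (Λ : KGraph k) [Λ.IsFinite] : Submodule ℂ Λ.L2 :=
  LinearMap.range (Lp.constₗ (E := ℂ) 2 Λ.pathMeasure ℂ)

/-- `ℛ_s` for `s ≥ 0`, the span of the `χ_{[η]}` with `d(η)_i ≤ s` for all `i`. -/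
noncomputable def boxSpace (Λ : KGraph k) [Λ.IsFinite] (s : ℕ) : Submodule ℂ Λ.L2 :=
  Submodule.span ℂ (Λ.chi '' {η | ∀ i, Λ.degree η i ≤ s})

/-- `ℛ_{q-1}` for `q ≥ 0`. -/
noncomputable def prevBoxSpace (Λ : KGraph k) [Λ.IsFinite] : ℕ → Submodule ℂ Λ.L2
  | 0 => Λ.constSpace
  | q + 1 => Λ.boxSpace q

instance (Λ : KGraph k) [Λ.IsFinite] : FiniteDimensional ℂ Λ.constSpace := by
  unfold constSpace
  infer_instance

instance (Λ : KGraph k) [Λ.IsFinite] (s : ℕ) : FiniteDimensional ℂ (Λ.boxSpace s) := by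
  refine FiniteDimensional.span_of_finite ℂ (Set.Finite.image _ ?_)
  have h : {η : Λ.Path | ∀ i, Λ.degree η i ≤ s} =
      ⋃ n ∈ Set.Iic (fun _ : Fin k => s), {η : Λ.Path | Λ.degree η = n} := by
    ext η
    simp [Pi.le_def]
  rw [h]
  exact (Set.finite_Iic _).biUnion fun n _ => IsFinite.finite_degree n

instance (Λ : KGraph k) [Λ.IsFinite] (q : ℕ) : FiniteDimensional ℂ (Λ.prevBoxSpace q) := by
  cases q <;> (unfold prevBoxSpace; infer_instance)

/-- `Ξ_q - Ξ_{q-1}`, where `Ξ_s` is the orthogonal projection of `L²(Λ^∞, M)` onto `ℛ_s`. -/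
noncomputable def xiDiff (Λ : KGraph k) [Λ.IsFinite] (q : ℕ) : Λ.L2 →L[ℂ] Λ.L2 :=
  (Λ.boxSpace q).starProjection - (Λ.prevBoxSpace q).starProjection

/-- The unbounded operator `D = ∑_q α_q (Ξ_q - Ξ_{q-1})` on its maximal domain, the set of all `f`
for which the series `∑_q α_q (Ξ_q - Ξ_{q-1}) f` converges in `L²(Λ^∞, M)`. (Its terms are pairwise
orthogonal, so convergence, unconditional convergence and
`∑_q α_q² ‖(Ξ_q - Ξ_{q-1}) f‖² < ∞` are the same.) -/
noncomputable def dirac (Λ : KGraph k) [Λ.IsFinite] (α : ℕ → ℝ) : Λ.L2 →ₗ.[ℂ] Λ.L2 where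
  domain :=
    { carrier := {f | Summable fun q => (α q : ℂ) • Λ.xiDiff q f}
      zero_mem' := by
        change Summable fun q => (α q : ℂ) • Λ.xiDiff q 0
        simp only [map_zero, smul_zero]
        exact summable_zero
      add_mem' := by
        intro f g hf hg
        change Summable fun q => (α q : ℂ) • Λ.xiDiff q (f + g)
        simpa only [map_add, smul_add] using Summable.add hf hg
      smul_mem' := by
        intro c f hf
        change Summable fun q => (α q : ℂ) • Λ.xiDiff q (c • f)
        simpa only [map_smul, smul_comm _ c] using Summable.const_smul c hf }
  toFun :=
    { toFun := fun f => ∑' q, (α q : ℂ) • Λ.xiDiff q (f : Λ.L2)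
      map_add' := by
        intro f g
        simpa only [Submodule.coe_add, map_add, smul_add] using Summable.tsum_add f.2 g.2
      map_smul' := by
        intro c f
        simpa only [Submodule.coe_smul, map_smul, smul_comm _ c, RingHom.id_apply] using
          Summable.tsum_const_smul c f.2 }

/-- The eigenspace `{f ∈ dom T : T f = z f}` of an unbounded operator `T` (the zero space when `z`
is not an eigenvalue). -/
def eigenspace {E : Type*} [AddCommGroup E] [Module ℂ E] (T : E →ₗ.[ℂ] E) (z : ℂ) :
    Submodule ℂ E :=
  (LinearMap.ker (T.toFun - z • T.domain.subtype)).map T.domain.subtype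

end KGraph

/-! A cylinder is the disjoint union of the cylinders of its extensions of any fixed larger degree,
so `χ_[η]` lies in `𝒱_s` whenever `d(η) ≤ (s,…,s)`. Hence `ℛ_s = 𝒱_s` (`boxSpace_eq_scalingSpace`),
and `𝒲_q = ℛ_{q+1} ∩ ℛ_q^⊥` follows at once. Square cylinders form a π-system generating the Borel
sets, so the union of the `ℛ_s` is dense (`eq_zero_of_forall_mem_boxSpace_orthogonal`), and its
successive orthogonal differences give the Hilbert sum.

The operators `Ξ_q - Ξ_{q-1}` project onto mutually orthogonal spaces which, with the constants,
exhaust `L²`. Applied to `Df = zf`, such an operator leaves `(α_q - z)(Ξ_q - Ξ_{q-1})f = 0`; the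
projection onto the constants leaves `z Ξ_{-1}f = 0`. Since the `α_q` are nonzero and distinct, at
most one component of `f` survives.

The translates rest on self-similarity: `σ^{d(μ)}` carries `M` on `[μ]` to `ρ(Λ)^{-d(μ)} M` on
`[s(μ)]` (`IsPathMeasure.map_shift`). Sorting the paths of degree `(q+1,…,q+1)` by their initial
segment `μ` of degree `(q,…,q)` writes `𝒱_{q+1}` as the sum of the `S_μ 𝒱_1`, and orthogonality to
`χ_[μ]` turns into orthogonality to `χ_[s(μ)]`.

`perronVector` and `pathMeasure` default to 0, so existence must be proved. A suitable sum of the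
commuting transfer operators `T_n` is strictly positive, and Perron's theorem yields a common
positive eigenvector. The equations `T_n x = ρ(Λ)^n x` make the prescribed cylinder masses additive,
so the unit interval can be cut into nested pieces of these masses; sending a point to the infinite
path it determines pushes Lebesgue measure to `M`. -/

namespace KGraph

variable {k : ℕ}

/-! ### Factorization of paths, infinite paths and cylinders -/

section Paths

variable {Λ : KGraph k}

/-- This is uniqueness in the factorization property, in cancellation form. Most path identities
below come from comparing two factorizations of one path. -/
theorem comp_inj {μ ν μ' ν' : Λ.Path} {h : Λ.source μ = Λ.range ν} {h' : Λ.source μ' = Λ.range ν'}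
    (he : Λ.comp μ ν h = Λ.comp μ' ν' h') (hd : Λ.degree μ = Λ.degree μ') : μ = μ' ∧ ν = ν' := by
  have h1 := Λ.degree_comp μ ν h
  have h2 := Λ.degree_comp μ' ν' h'
  have h3 : Λ.degree ν' = Λ.degree ν := by
    rw [he, h2, hd] at h1
    exact add_left_cancel h1
  have := (Λ.factorization _ _ _ h1).unique (y₁ := (μ, ν)) (y₂ := (μ', ν'))
    ⟨rfl, rfl, h, rfl⟩ ⟨hd.symm, h3, h', he.symm⟩
  simpa using this

theorem eq_one_of_degree_eq_zero {η : Λ.Path} (h : Λ.degree η = 0) : η = Λ.one (Λ.range η) :=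
  (comp_inj ((Λ.comp_one η).trans (Λ.one_comp η).symm) (h.trans (Λ.degree_one _).symm)).1

theorem exists_factor {η : Λ.Path} {m : Fin k → ℕ} (hm : m ≤ Λ.degree η) :
    ∃ p : Λ.Path × Λ.Path, Λ.degree p.1 = m ∧ ∃ h, Λ.comp p.1 p.2 h = η := by
  obtain ⟨p, hp, -⟩ := Λ.factorization η m (Λ.degree η - m) (add_tsub_cancel_of_le hm).symm
  exact ⟨p, hp.1, hp.2.2⟩

open Classical in
/-- The initial segment of degree `m` of `η` (and `η` itself if there is none). -/
noncomputable def take (η : Λ.Path) (m : Fin k → ℕ) : Λ.Path :=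
  if h : m ≤ Λ.degree η then (exists_factor h).choose.1 else η

open Classical in
/-- What is left of `η` after its initial segment of degree `m`. -/
noncomputable def drop (η : Λ.Path) (m : Fin k → ℕ) : Λ.Path :=
  if h : m ≤ Λ.degree η then (exists_factor h).choose.2 else Λ.one (Λ.source η)

variable {η : Λ.Path} {m n : Fin k → ℕ}

theorem degree_take (h : m ≤ Λ.degree η) : Λ.degree (take η m) = m := by
  rw [take, dif_pos h]
  exact (exists_factor h).choose_spec.1

theorem source_take (h : m ≤ Λ.degree η) : Λ.source (take η m) = Λ.range (drop η m) := by
  rw [take, drop, dif_pos h, dif_pos h]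
  exact (exists_factor h).choose_spec.2.1

theorem comp_take_drop (h : m ≤ Λ.degree η) :
    Λ.comp (take η m) (drop η m) (source_take h) = η := by
  have := (exists_factor h).choose_spec.2.2
  simpa only [take, drop, dif_pos h] using this

theorem range_take (h : m ≤ Λ.degree η) : Λ.range (take η m) = Λ.range η := by
  conv_rhs => rw [← comp_take_drop h, Λ.range_comp]

theorem source_drop (h : m ≤ Λ.degree η) : Λ.source (drop η m) = Λ.source η := by
  conv_rhs => rw [← comp_take_drop h, Λ.source_comp]

theorem degree_drop (h : m ≤ Λ.degree η) : Λ.degree (drop η m) = Λ.degree η - m := by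
  have := Λ.degree_comp _ _ (source_take h)
  rw [comp_take_drop h, degree_take h] at this
  rw [this, add_tsub_cancel_left]

theorem take_drop_comp (μ ν : Λ.Path) (h : Λ.source μ = Λ.range ν) :
    take (Λ.comp μ ν h) (Λ.degree μ) = μ ∧ drop (Λ.comp μ ν h) (Λ.degree μ) = ν := by
  have hle : Λ.degree μ ≤ Λ.degree (Λ.comp μ ν h) := by
    rw [Λ.degree_comp]; exact le_self_add
  exact comp_inj (comp_take_drop hle) (degree_take hle)

theorem take_take (hmn : m ≤ n) (h : n ≤ Λ.degree η) : take (take η n) m = take η m := by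
  have hm : m ≤ Λ.degree (take η n) := by rwa [degree_take h]
  have e := comp_take_drop h
  have e' : Λ.comp (Λ.comp (take (take η n) m) (drop (take η n) m) (source_take hm)) (drop η n)
      ((Λ.source_comp _ _ _).trans ((source_drop hm).trans (source_take h))) = η := by
    simpa only [comp_take_drop hm] using e
  rw [Λ.comp_assoc _ _ _ (source_take hm) ((source_drop hm).trans (source_take h))] at e'
  refine (comp_inj (e'.trans (comp_take_drop (hmn.trans h)).symm) ?_).1
  rw [degree_take hm, degree_take (hmn.trans h)]

theorem take_self (η : Λ.Path) : take η (Λ.degree η) = η := by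
  have := (take_drop_comp η (Λ.one (Λ.source η)) (Λ.range_one _).symm).1
  rwa [Λ.comp_one] at this

/-- The infinite path whose initial segments are given by a coherent family of paths. -/
noncomputable def InfinitePath.ofPrefixes (p : (Fin k → ℕ) → Λ.Path)
    (hd : ∀ m, Λ.degree (p m) = m) (hp : ∀ m n, m ≤ n → take (p n) m = p m) :
    Λ.InfinitePath :=
  have hle : ∀ {m n}, m ≤ n → m ≤ Λ.degree (p n) := fun h => h.trans (hd _).ge
  have hsrc : ∀ {m n}, m ≤ n → Λ.range (drop (p n) m) = Λ.source (p m) := fun {m n} h => by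
    rw [← source_take (hle h), hp m n h]
  have hcomp : ∀ {m n} (h : m ≤ n), Λ.comp (p m) (drop (p n) m) (hsrc h).symm = p n := by
    intro m n h
    have := comp_take_drop (hle h)
    simpa only [hp m n h] using this
  { obj := fun m => Λ.source (p m)
    -- The segment `x(m, n)` is forced: it is what remains of `p n` after its prefix `p m`.
    -- Functoriality is then uniqueness of factorization.
    seg := fun m n _ => drop (p n) m
    range_seg := fun m n h => hsrc h
    source_seg := fun m n h => source_drop (hle h)
    seg_self := fun m => (comp_inj ((hcomp le_rfl).trans (Λ.comp_one (p m)).symm) rfl).2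
    seg_comp := fun m n q h₁ h₂ => by
      have hs : Λ.source (drop (p n) m) = Λ.range (drop (p q) n) :=
        (source_drop (hle h₁)).trans (hsrc h₂).symm
      have e : Λ.comp (Λ.comp (p m) (drop (p n) m) (hsrc h₁).symm) (drop (p q) n)
          ((Λ.source_comp _ _ _).trans hs) = p q := by
        simpa only [hcomp h₁] using hcomp h₂
      rw [Λ.comp_assoc _ _ _ (hsrc h₁).symm hs] at e
      exact (comp_inj (e.trans (hcomp (h₁.trans h₂)).symm) rfl).2
    degree_seg := fun m n h => by rw [degree_drop (hle h), hd] }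

theorem drop_zero (η : Λ.Path) : drop η 0 = η := by
  have h : (0 : Fin k → ℕ) ≤ Λ.degree η := fun _ => Nat.zero_le _
  exact (comp_inj ((comp_take_drop h).trans (Λ.one_comp η).symm)
    ((degree_take h).trans (Λ.degree_one _).symm)).2

namespace InfinitePath

variable (x : Λ.InfinitePath)

theorem seg_congr {m n m' n' : Fin k → ℕ} (hm : m = m') (hn : n = n') (h : m ≤ n) (h' : m' ≤ n') :
    x.seg m n h = x.seg m' n' h' := by
  subst hm hn; rfl

/-- The initial segment of degree `n` of an infinite path. -/
def pre (n : Fin k → ℕ) : Λ.Path := x.seg 0 n (fun _ => Nat.zero_le _)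

theorem degree_pre (n : Fin k → ℕ) : Λ.degree (x.pre n) = n := by
  rw [pre, x.degree_seg, tsub_zero]

theorem take_pre (hmn : m ≤ n) : take (x.pre n) m = x.pre m := by
  have := (take_drop_comp _ _ ((x.source_seg 0 m (fun _ => Nat.zero_le _)).trans
    (x.range_seg m n hmn).symm)).1
  rw [x.seg_comp, x.degree_seg, tsub_zero] at this
  exact this

theorem source_pre (n : Fin k → ℕ) : Λ.source (x.pre n) = x.obj n := x.source_seg _ _ _

theorem pre_add (m n : Fin k → ℕ) : Λ.comp (x.pre m) ((shift m x).pre n)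
    (((x.source_pre m).trans (congrArg x.obj (zero_add m).symm)).trans
      ((shift m x).range_seg 0 n _).symm) =
      x.pre (m + n) := by
  have e : (shift m x).pre n = x.seg m (m + n) le_self_add :=
    x.seg_congr (zero_add m) (add_comm n m) _ _
  simp only [e]
  exact x.seg_comp 0 m (m + n) _ _

theorem pre_ofPrefixes (p : (Fin k → ℕ) → Λ.Path)
    (hd : ∀ m, Λ.degree (p m) = m) (hp : ∀ m n, m ≤ n → take (p n) m = p m) (n : Fin k → ℕ) :
    (ofPrefixes p hd hp).pre n = p n :=
  drop_zero (p n)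

theorem pre_zero : x.pre 0 = Λ.one (x.obj 0) := x.seg_self 0

end InfinitePath

variable {x : Λ.InfinitePath}

theorem mem_cylinder : x ∈ cylinder η ↔ x.pre (Λ.degree η) = η := Iff.rfl

theorem mem_cylinder_pre (x : Λ.InfinitePath) (n : Fin k → ℕ) : x ∈ cylinder (x.pre n) := by
  rw [mem_cylinder, x.degree_pre]

theorem mem_cylinder_iff_of_degree (h : Λ.degree η = n) : x ∈ cylinder η ↔ x.pre n = η := by
  rw [mem_cylinder, h]

theorem mem_cylinder_one {v : Λ.Vertex} : x ∈ cylinder (Λ.one v) ↔ x.obj 0 = v := by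
  rw [mem_cylinder_iff_of_degree (Λ.degree_one v), x.pre_zero]
  refine ⟨fun h => ?_, fun h => by rw [h]⟩
  rw [← Λ.range_one (x.obj 0), h, Λ.range_one]

theorem range_eq_obj_of_mem_cylinder (h : x ∈ cylinder η) : Λ.range η = x.obj 0 := by
  rw [← mem_cylinder.1 h]
  exact x.range_seg _ _ _

theorem source_eq_of_mem_cylinder (h : x ∈ cylinder η) :
    Λ.source η = (shift (Λ.degree η) x).obj 0 := by
  conv_lhs => rw [← mem_cylinder.1 h]
  rw [x.source_pre]
  change x.obj _ = x.obj (0 + _)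
  rw [zero_add]

theorem mem_cylinder_comp {μ ν : Λ.Path} {h : Λ.source μ = Λ.range ν} :
    x ∈ cylinder (Λ.comp μ ν h) ↔ x ∈ cylinder μ ∧ shift (Λ.degree μ) x ∈ cylinder ν := by
  rw [mem_cylinder_iff_of_degree (Λ.degree_comp μ ν h), ← x.pre_add]
  constructor
  · intro e
    exact comp_inj e (x.degree_pre _)
  · rintro ⟨h1, h2⟩
    simp only [mem_cylinder.1 h1, mem_cylinder.1 h2]

theorem disjoint_cylinder {μ ν : Λ.Path} (hd : Λ.degree μ = Λ.degree ν) (hne : μ ≠ ν) :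
    Disjoint (cylinder μ) (cylinder ν) := by
  rw [Set.disjoint_left]
  intro x h1 h2
  rw [mem_cylinder, hd] at h1
  exact hne (h1.symm.trans h2)

theorem mem_cylinder_iff_take (hn : Λ.degree η ≤ n) :
    x ∈ cylinder η ↔ take (x.pre n) (Λ.degree η) = η := by
  rw [x.take_pre hn, mem_cylinder]

/-- A cylinder is the union of the cylinders of its extensions of a given larger degree. -/
theorem cylinder_eq_iUnion (hn : Λ.degree η ≤ n) :
    cylinder η = ⋃ μ ∈ {μ : Λ.Path | Λ.degree μ = n ∧ take μ (Λ.degree η) = η}, cylinder μ := by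
  ext x
  simp only [Set.mem_ofPred_eq, Set.mem_iUnion, exists_prop]
  constructor
  · intro h
    exact ⟨x.pre n, ⟨x.degree_pre n, (mem_cylinder_iff_take hn).1 h⟩, mem_cylinder_pre x n⟩
  · rintro ⟨μ, ⟨h1, h2⟩, h3⟩
    rw [mem_cylinder_iff_take hn, (mem_cylinder_iff_of_degree h1).1 h3, h2]

end Paths

end KGraph

namespace KGraph

variable {k : ℕ}

/-! ### The Borel structure of the path space -/

section Measurability

variable {Λ : KGraph k}

theorem exists_degree_le_const (n : Fin k → ℕ) : ∃ N : ℕ, n ≤ fun _ => N :=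
  ⟨Finset.univ.sup n, fun i => Finset.le_sup (f := n) (Finset.mem_univ i)⟩

/-- The cylinder sets of paths of degree `(n, …, n)`, for all `n`. -/
def squareCylinders (Λ : KGraph k) : Set (Set Λ.InfinitePath) :=
  {S | ∃ (η : Λ.Path) (n : ℕ), (Λ.degree η = fun _ => n) ∧ cylinder η = S}

theorem cylinder_subset_of_le {η μ : Λ.Path} (hd : Λ.degree η ≤ Λ.degree μ)
    (hne : (cylinder η ∩ cylinder μ).Nonempty) : cylinder μ ⊆ cylinder η := by
  obtain ⟨x, h1, h2⟩ := hne
  intro y hy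
  rw [mem_cylinder_iff_take hd] at h1 ⊢
  rw [mem_cylinder.1 hy]
  rwa [mem_cylinder.1 h2] at h1

/-- Square degrees are totally ordered, and two cylinders of comparable degrees that meet are
nested. For incomparable degrees this nesting can fail, hence the restriction to squares. -/
theorem isPiSystem_squareCylinders (Λ : KGraph k) : IsPiSystem Λ.squareCylinders := by
  rintro _ ⟨η, n, hη, rfl⟩ _ ⟨μ, m, hμ, rfl⟩ hne
  rcases le_total n m with h | h
  · have hd : Λ.degree η ≤ Λ.degree μ := by rw [hη, hμ]; exact fun _ => h
    rw [Set.inter_eq_right.2 (cylinder_subset_of_le hd hne)]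
    exact ⟨μ, m, hμ, rfl⟩
  · have hd : Λ.degree μ ≤ Λ.degree η := by rw [hη, hμ]; exact fun _ => h
    rw [Set.inter_eq_left.2 (cylinder_subset_of_le hd (by rwa [Set.inter_comm]))]
    exact ⟨η, n, hη, rfl⟩

theorem borel_eq_generateFrom_cylinders (Λ : KGraph k) :
    borel Λ.InfinitePath =
      MeasurableSpace.generateFrom (Set.range fun η : Λ.Path => cylinder η) := by
  have := Λ.countable_path
  have : SecondCountableTopology Λ.InfinitePath :=
    ⟨⟨_, Set.countable_range _, rfl⟩⟩
  exact borel_eq_generateFrom_of_subbasis rfl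

/-- Every cylinder is a countable union of square cylinders, by extending its path to a large enough
square degree. -/
theorem measurableSpace_eq_generateFrom (Λ : KGraph k) :
    (inferInstance : MeasurableSpace Λ.InfinitePath) =
      MeasurableSpace.generateFrom Λ.squareCylinders := by
  have := Λ.countable_path
  apply le_antisymm
  · change borel _ ≤ _
    rw [borel_eq_generateFrom_cylinders]
    refine MeasurableSpace.generateFrom_le ?_
    rintro _ ⟨η, rfl⟩
    obtain ⟨N, hN⟩ := exists_degree_le_const (Λ.degree η)
    beta_reduce
    rw [cylinder_eq_iUnion hN]
    exact @MeasurableSet.biUnion _ _ (MeasurableSpace.generateFrom Λ.squareCylinders) _ _ (Set.to_countable _) fun μ hμ =>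
      MeasurableSpace.measurableSet_generateFrom ⟨μ, N, hμ.1, rfl⟩
  · refine MeasurableSpace.generateFrom_le ?_
    rintro _ ⟨η, n, -, rfl⟩
    exact measurableSet_cylinder η

theorem measurable_shift (p : Fin k → ℕ) : Measurable (shift p : Λ.InfinitePath → _) := by
  have := Λ.countable_path
  have : (inferInstance : MeasurableSpace Λ.InfinitePath) = _ := borel_eq_generateFrom_cylinders Λ
  refine Measurable.of_le_map (this.le.trans (MeasurableSpace.generateFrom_le ?_))
  rintro _ ⟨η, rfl⟩
  change MeasurableSet (shift p ⁻¹' cylinder η)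
  -- The preimage is the union of the `[μη]` with `d(μ) = p`. Pairs `(μ, μη)` index it because the
  -- composite needs a proof that it is defined.
  have : shift p ⁻¹' cylinder η = ⋃ μ ∈ {μ : Λ.Path × Λ.Path | Λ.degree μ.1 = p ∧
      ∃ h, μ.2 = Λ.comp μ.1 η h}, cylinder μ.2 := by
    ext x
    simp only [Set.mem_preimage, Set.mem_iUnion, exists_prop, Set.mem_ofPred_eq, Prod.exists]
    constructor
    · intro hx
      have h1 := mem_cylinder_pre x p
      have hs : Λ.source (x.pre p) = Λ.range η := by
        rw [source_eq_of_mem_cylinder h1, x.degree_pre, range_eq_obj_of_mem_cylinder hx]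
      refine ⟨x.pre p, Λ.comp (x.pre p) η hs, ⟨x.degree_pre p, hs, rfl⟩, mem_cylinder_comp.2 ⟨h1, ?_⟩⟩
      rwa [x.degree_pre]
    · rintro ⟨μ, μ', ⟨h1, h2, h4⟩, h3⟩
      rw [h4] at h3
      rw [← h1]
      exact (mem_cylinder_comp.1 h3).2
  rw [this]
  exact MeasurableSet.biUnion (Set.to_countable _) fun μ _ => measurableSet_cylinder _

theorem cylinder_inter_preimage_shift {μ ν : Λ.Path} (h : Λ.source μ = Λ.range ν) :
    cylinder μ ∩ shift (Λ.degree μ) ⁻¹' cylinder ν = cylinder (Λ.comp μ ν h) := by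
  ext x
  exact mem_cylinder_comp.symm

theorem cylinder_inter_preimage_shift_of_ne {μ ν : Λ.Path} (h : Λ.source μ ≠ Λ.range ν) :
    cylinder μ ∩ shift (Λ.degree μ) ⁻¹' cylinder ν = ∅ := by
  refine Set.eq_empty_of_forall_notMem fun x ⟨h1, h2⟩ => h ?_
  rw [source_eq_of_mem_cylinder h1, range_eq_obj_of_mem_cylinder h2]

theorem cylinder_inter_cylinder_one (ν : Λ.Path) :
    cylinder ν ∩ cylinder (Λ.one (Λ.range ν)) = cylinder ν := by
  refine Set.inter_eq_left.2 fun x hx => ?_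
  rw [mem_cylinder_one, range_eq_obj_of_mem_cylinder hx]

theorem cylinder_inter_cylinder_one_of_ne {ν : Λ.Path} {v : Λ.Vertex} (h : v ≠ Λ.range ν) :
    cylinder ν ∩ cylinder (Λ.one v) = ∅ := by
  refine Set.eq_empty_of_forall_notMem fun x ⟨h1, h2⟩ => h ?_
  rw [range_eq_obj_of_mem_cylinder h1, mem_cylinder_one.1 h2]

end Measurability

/-! ### Scaling of the measure under the shift -/

section PathMeasure

variable {Λ : KGraph k} [Λ.IsFinite] {M : Measure Λ.InfinitePath}

theorem rhoPow_nonneg (n : Fin k → ℕ) : 0 ≤ Λ.rhoPow n :=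
  Finset.prod_nonneg fun _ _ => pow_nonneg ENNReal.toReal_nonneg _

theorem rhoPow_add (m n : Fin k → ℕ) : Λ.rhoPow (m + n) = Λ.rhoPow m * Λ.rhoPow n := by
  simp [rhoPow, pow_add, Finset.prod_mul_distrib]

theorem rhoPow_zero : Λ.rhoPow 0 = 1 := by simp [rhoPow]

theorem rhoPow_pos (h : ∀ i, 0 < Λ.rho i) (n : Fin k → ℕ) : 0 < Λ.rhoPow n :=
  Finset.prod_pos fun i _ => pow_pos (h i) _

theorem finite_degree_and (n : Fin k → ℕ) (p : Λ.Path → Prop) :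
    {η : Λ.Path | Λ.degree η = n ∧ p η}.Finite :=
  (IsFinite.finite_degree n).subset fun _ h => h.1

theorem IsPathMeasure.measure_cylinder_comp (hM : Λ.IsPathMeasure M) {μ ν : Λ.Path}
    (h : Λ.source μ = Λ.range ν) : M (cylinder (Λ.comp μ ν h)) =
      ENNReal.ofReal (Λ.rhoPow (Λ.degree μ))⁻¹ * M (cylinder ν) := by
  rw [hM.2, hM.2, Λ.degree_comp, Λ.source_comp, rhoPow_add, mul_inv, mul_assoc,
    ENNReal.ofReal_mul (inv_nonneg.2 (rhoPow_nonneg _))]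

/-- On the cylinder of `μ`, the shift by `d(μ)` scales the measure by `ρ(Λ)^{-d(μ)}`. -/
theorem IsPathMeasure.map_shift (hM : Λ.IsPathMeasure M) (μ : Λ.Path) :
    (M.restrict (cylinder μ)).map (shift (Λ.degree μ)) =
      ENNReal.ofReal (Λ.rhoPow (Λ.degree μ))⁻¹ •
        M.restrict (cylinder (Λ.one (Λ.source μ))) := by
  have := hM.1
  refine ext_of_generate_finite _ (measurableSpace_eq_generateFrom Λ)
    (isPiSystem_squareCylinders Λ) ?_ ?_
  · rintro _ ⟨ν, n, -, rfl⟩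
    rw [Measure.map_apply (measurable_shift _) (measurableSet_cylinder _),
      Measure.restrict_apply (measurable_shift _ (measurableSet_cylinder _)),
      Measure.smul_apply, Measure.restrict_apply (measurableSet_cylinder _), Set.inter_comm,
      smul_eq_mul]
    by_cases h : Λ.source μ = Λ.range ν
    · rw [cylinder_inter_preimage_shift h, h, cylinder_inter_cylinder_one,
        hM.measure_cylinder_comp]
    · rw [cylinder_inter_preimage_shift_of_ne h, cylinder_inter_cylinder_one_of_ne h]
      simp
  -- Total masses agree because `μ` is `μ` followed by the identity at its source.
  · rw [Measure.map_apply (measurable_shift _) MeasurableSet.univ, Set.preimage_univ,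
      Measure.restrict_apply_univ, Measure.smul_apply, Measure.restrict_apply_univ, smul_eq_mul,
      ← hM.measure_cylinder_comp (Λ.range_one _).symm, Λ.comp_one]

end PathMeasure

/-! ### Spans of cylinder functions and their density -/

section L2

variable {Λ : KGraph k} [Λ.IsFinite]

theorem inner_chi_chi (η μ : Λ.Path) : inner ℂ (Λ.chi η) (Λ.chi μ) =
    ((Λ.pathMeasure.real (cylinder η ∩ cylinder μ) : ℝ) : ℂ) := by
  rw [chi, chi, L2.inner_indicatorConstLp_indicatorConstLp]
  simp

theorem chi_ae (η : Λ.Path) :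
    Λ.chi η =ᵐ[Λ.pathMeasure] (cylinder η).indicator fun _ => (1 : ℂ) :=
  indicatorConstLp_coeFn

theorem sum_chi_ae (s : Finset Λ.Path) {n : Fin k → ℕ} (hs : ∀ μ ∈ s, Λ.degree μ = n) :
    (∑ μ ∈ s, Λ.chi μ : Λ.L2) =ᵐ[Λ.pathMeasure]
      (⋃ μ ∈ s, cylinder μ).indicator fun _ => (1 : ℂ) := by
  classical
  induction s using Finset.induction_on with
  | empty =>
    simp only [Finset.sum_empty, Finset.notMem_empty, Set.iUnion_of_empty, Set.iUnion_empty,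
      Set.indicator_empty]
    exact Lp.coeFn_zero _ _ _
  | insert a s ha ih =>
    rw [Finset.sum_insert ha]
    filter_upwards [Lp.coeFn_add (Λ.chi a) (∑ μ ∈ s, Λ.chi μ), chi_ae a,
      ih fun μ hμ => hs μ (Finset.mem_insert_of_mem hμ)] with x h1 h2 h3
    rw [h1, Pi.add_apply, h2, h3, Finset.set_biUnion_insert, Set.indicator_union_of_disjoint]
    rw [Set.disjoint_iUnion₂_right]
    intro μ hμ
    refine disjoint_cylinder ?_ (fun h => ha (h ▸ hμ))
    rw [hs a (Finset.mem_insert_self _ _), hs μ (Finset.mem_insert_of_mem hμ)]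

/-- `χ_{[η]}` is the sum of the `χ_{[μ]}` over the extensions `μ` of `η` of a given degree. -/
theorem chi_eq_sum {η : Λ.Path} {n : Fin k → ℕ} (hn : Λ.degree η ≤ n) : Λ.chi η =
    ∑ μ ∈ (finite_degree_and n fun μ => take μ (Λ.degree η) = η).toFinset, Λ.chi μ := by
  refine Lp.ext ((chi_ae η).trans ?_)
  refine EventuallyEq.trans ?_ (sum_chi_ae (n := n) _ fun μ hμ => ?_).symm
  · rw [cylinder_eq_iUnion hn]
    simp only [Set.Finite.mem_toFinset]
    rfl
  · exact ((Set.Finite.mem_toFinset _).1 hμ).1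

/-- The cylinders of degree 0 partition the path space. This places `ℛ_{-1}` inside `ℛ_0`. -/
theorem const_eq_smul_sum (c : ℂ) : Lp.const 2 Λ.pathMeasure c =
    c • ∑ μ ∈ (IsFinite.finite_degree (Λ := Λ) 0).toFinset, Λ.chi μ := by
  refine Lp.ext ?_
  filter_upwards [Lp.coeFn_const (p := 2) (μ := Λ.pathMeasure) (c := c),
    Lp.coeFn_smul c (∑ μ ∈ (IsFinite.finite_degree (Λ := Λ) 0).toFinset, Λ.chi μ),
    sum_chi_ae (IsFinite.finite_degree (Λ := Λ) 0).toFinset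
      (n := 0) (fun μ hμ => by simpa using hμ)] with x h1 h2 h3
  rw [h1, h2, Pi.smul_apply, h3, Set.indicator_of_mem, smul_eq_mul, mul_one, Function.const_apply]
  simp only [Set.Finite.mem_toFinset, Set.mem_iUnion, exists_prop]
  exact ⟨x.pre 0, x.degree_pre 0, mem_cylinder_pre x 0⟩

/-- Any path of degree at most `(s,…,s)` can be extended to that degree, and `chi_eq_sum` expands
its function accordingly. -/
theorem boxSpace_eq_scalingSpace (s : ℕ) : Λ.boxSpace s = Λ.scalingSpace s := by
  apply le_antisymm
  · refine Submodule.span_le.2 ?_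
    rintro _ ⟨η, hη, rfl⟩
    rw [SetLike.mem_coe, chi_eq_sum (n := fun _ => s) hη]
    refine Submodule.sum_mem _ fun μ hμ => Submodule.subset_span ⟨μ, ?_, rfl⟩
    exact ((Set.Finite.mem_toFinset _).1 hμ).1
  · refine Submodule.span_mono (Set.image_mono ?_)
    intro η hη i
    rw [Set.mem_ofPred_eq] at hη
    rw [hη]

theorem boxSpace_mono : Monotone Λ.boxSpace := fun _ _ h =>
  Submodule.span_mono (Set.image_mono fun _ hη i => (hη i).trans h)

theorem constSpace_le_boxSpace_zero : Λ.constSpace ≤ Λ.boxSpace 0 := by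
  rintro _ ⟨c, rfl⟩
  rw [Lp.constₗ_apply, const_eq_smul_sum]
  refine Submodule.smul_mem _ _ (Submodule.sum_mem _ fun μ hμ => Submodule.subset_span
    ⟨_, fun i => ?_, rfl⟩)
  rw [(Set.Finite.mem_toFinset _).1 hμ]
  rfl

/-- The span of the characteristic functions of square cylinder sets is dense. -/
theorem eq_zero_of_forall_mem_boxSpace_orthogonal (f : Λ.L2) (h : ∀ n, f ∈ (Λ.boxSpace n)ᗮ) :
    f = 0 := by
  have hint : Integrable f Λ.pathMeasure := (Lp.memLp f).integrable one_le_two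
  have hsq : ∀ S ∈ Λ.squareCylinders, ∫ x in S, f x ∂Λ.pathMeasure = 0 := by
    rintro _ ⟨η, n, hη, rfl⟩
    rw [← L2.inner_indicatorConstLp_one (𝕜 := ℂ) (measurableSet_cylinder η) (measure_ne_top _ _) f]
    exact h n _ (Submodule.subset_span ⟨η, fun i => by rw [hη], rfl⟩)
  have huniv : ∫ x, f x ∂Λ.pathMeasure = 0 := by
    rw [← setIntegral_univ, ← L2.inner_indicatorConstLp_one (𝕜 := ℂ) MeasurableSet.univ
      (measure_ne_top _ _) f, indicatorConstLp_univ]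
    exact h 0 _ (constSpace_le_boxSpace_zero ⟨1, rfl⟩)
  -- Dynkin's π-λ theorem: the sets over which `f` integrates to 0 are closed under complements and
  -- countable disjoint unions.
  have hall : ∀ S, MeasurableSet S → ∫ x in S, f x ∂Λ.pathMeasure = 0 := by
    refine MeasurableSpace.induction_on_inter (measurableSpace_eq_generateFrom Λ)
      (isPiSystem_squareCylinders Λ) (by simp) hsq ?_ ?_
    · intro t ht h0
      rw [setIntegral_compl ht hint, huniv, h0, sub_zero]
    · intro g hd hg h0
      rw [integral_iUnion hg hd hint.integrableOn]
      simp [h0]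
  refine (Lp.eq_zero_iff_ae_eq_zero).2 ?_
  exact hint.ae_eq_zero_of_forall_setIntegral_eq_zero fun S hS _ => hall S hS

end L2
end KGraph

namespace KGraph

variable {k : ℕ}

/-! ### The operators `S_μ` and the wavelet spaces -/

section Translates

variable {Λ : KGraph k} [Λ.IsFinite]

/-- By the scaling law, the shift pulls null sets back to null subsets of `[μ]`. Hence `S_μ f` does
not depend on the representative of `f`. -/
theorem ae_shift_of_ae (hM : Λ.IsPathMeasure Λ.pathMeasure) (μ : Λ.Path)
    {p : Λ.InfinitePath → Prop} (h : ∀ᵐ y ∂Λ.pathMeasure, p y) :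
    ∀ᵐ x ∂Λ.pathMeasure, x ∈ cylinder μ → p (shift (Λ.degree μ) x) := by
  rw [← ae_restrict_iff' (measurableSet_cylinder μ)]
  refine ae_of_ae_map (measurable_shift _).aemeasurable ?_
  rw [hM.map_shift]
  exact Measure.ae_smul_measure (ae_restrict_of_ae h) _

theorem IsTranslate.unique {μ : Λ.Path} {f g g' : Λ.L2} (h : Λ.IsTranslate μ f g)
    (h' : Λ.IsTranslate μ f g') : g = g' :=
  Lp.ext (EventuallyEq.trans h (EventuallyEq.symm h'))

theorem IsTranslate.add (hM : Λ.IsPathMeasure Λ.pathMeasure) {μ : Λ.Path} {f g f' g' : Λ.L2}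
    (h : Λ.IsTranslate μ f g) (h' : Λ.IsTranslate μ f' g') :
    Λ.IsTranslate μ (f + f') (g + g') := by
  filter_upwards [h, h', Lp.coeFn_add g g', ae_shift_of_ae hM μ (Lp.coeFn_add f f')]
    with x h1 h2 h3 h4
  rw [h3, Pi.add_apply, h1, h2]
  by_cases hx : x ∈ cylinder μ
  · simp only [Set.indicator_of_mem hx, h4 hx, Pi.add_apply, mul_add]
  · simp only [Set.indicator_of_notMem hx, add_zero]

theorem IsTranslate.smul (hM : Λ.IsPathMeasure Λ.pathMeasure) {μ : Λ.Path} {f g : Λ.L2}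
    (c : ℂ) (h : Λ.IsTranslate μ f g) : Λ.IsTranslate μ (c • f) (c • g) := by
  filter_upwards [h, Lp.coeFn_smul c g, ae_shift_of_ae hM μ (Lp.coeFn_smul c f)] with x h1 h2 h3
  rw [h2, Pi.smul_apply, h1]
  by_cases hx : x ∈ cylinder μ
  · simp only [Set.indicator_of_mem hx, h3 hx, Pi.smul_apply, smul_eq_mul]
    ring
  · simp only [Set.indicator_of_notMem hx, smul_zero]

theorem IsTranslate.zero (hM : Λ.IsPathMeasure Λ.pathMeasure) (μ : Λ.Path) :
    Λ.IsTranslate μ 0 0 := by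
  filter_upwards [Lp.coeFn_zero ℂ 2 Λ.pathMeasure,
    ae_shift_of_ae hM μ (Lp.coeFn_zero ℂ 2 Λ.pathMeasure)] with x h1 h2
  rw [h1]
  by_cases hx : x ∈ cylinder μ
  · simp only [Set.indicator_of_mem hx, h2 hx, Pi.zero_apply, mul_zero]
  · simp only [Set.indicator_of_notMem hx, Pi.zero_apply]

theorem isTranslate_chi (hM : Λ.IsPathMeasure Λ.pathMeasure) {μ ν : Λ.Path}
    (h : Λ.source μ = Λ.range ν) : Λ.IsTranslate μ (Λ.chi ν)
      ((Real.sqrt (Λ.rhoPow (Λ.degree μ)) : ℂ) • Λ.chi (Λ.comp μ ν h)) := by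
  filter_upwards [Lp.coeFn_smul (Real.sqrt (Λ.rhoPow (Λ.degree μ)) : ℂ) (Λ.chi (Λ.comp μ ν h)),
    chi_ae (Λ.comp μ ν h), ae_shift_of_ae hM μ (chi_ae ν)] with x h1 h2 h3
  rw [h1, Pi.smul_apply, h2, ← cylinder_inter_preimage_shift h, smul_eq_mul]
  by_cases hx : x ∈ cylinder μ
  · simp only [Set.indicator_of_mem hx, h3 hx]
    by_cases hy : shift (Λ.degree μ) x ∈ cylinder ν
    · rw [Set.indicator_of_mem hy, Set.indicator_of_mem (Set.mem_inter hx hy)]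
    · rw [Set.indicator_of_notMem hy, Set.indicator_of_notMem fun hc => hy hc.2]
  · rw [Set.indicator_of_notMem hx, Set.indicator_of_notMem fun hc => hx hc.1, mul_zero]

theorem isTranslate_chi_of_ne (hM : Λ.IsPathMeasure Λ.pathMeasure) {μ ν : Λ.Path}
    (h : Λ.source μ ≠ Λ.range ν) : Λ.IsTranslate μ (Λ.chi ν) 0 := by
  filter_upwards [Lp.coeFn_zero ℂ 2 Λ.pathMeasure, ae_shift_of_ae hM μ (chi_ae ν)] with x h1 h2
  rw [h1]
  by_cases hx : x ∈ cylinder μ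
  · have hy : shift (Λ.degree μ) x ∉ cylinder ν := fun hy => by
      have : x ∈ cylinder μ ∩ shift (Λ.degree μ) ⁻¹' cylinder ν := ⟨hx, hy⟩
      rwa [cylinder_inter_preimage_shift_of_ne h] at this
    simp only [Set.indicator_of_mem hx, h2 hx, Set.indicator_of_notMem hy, Pi.zero_apply, mul_zero]
  · simp only [Set.indicator_of_notMem hx, Pi.zero_apply]

/-- The span of the characteristic functions of the cylinders of paths of degree `n`. -/
noncomputable def degreeSpace (Λ : KGraph k) [Λ.IsFinite] (n : Fin k → ℕ) : Submodule ℂ Λ.L2 :=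
  Submodule.span ℂ (Λ.chi '' {η | Λ.degree η = n})

theorem inner_chi_comp (hM : Λ.IsPathMeasure Λ.pathMeasure) {μ ν : Λ.Path}
    (h : Λ.source μ = Λ.range ν) : inner ℂ (Λ.chi μ) (Λ.chi (Λ.comp μ ν h)) =
      ((Λ.rhoPow (Λ.degree μ) : ℝ) : ℂ)⁻¹ *
        inner ℂ (Λ.chi (Λ.one (Λ.source μ))) (Λ.chi ν) := by
  rw [inner_chi_chi, inner_chi_chi, h, Set.inter_comm, Set.inter_comm _ (cylinder ν),
    cylinder_inter_cylinder_one, Set.inter_eq_left.2 fun x hx => (mem_cylinder_comp.1 hx).1,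
    Measure.real, hM.measure_cylinder_comp, ENNReal.toReal_mul,
    ENNReal.toReal_ofReal (inv_nonneg.2 (rhoPow_nonneg _))]
  push_cast
  rfl

theorem inner_chi_comp_of_ne {μ ν ξ : Λ.Path} (h : Λ.source μ = Λ.range ν)
    (hd : Λ.degree ξ = Λ.degree μ) (hne : ξ ≠ μ) :
    inner ℂ (Λ.chi ξ) (Λ.chi (Λ.comp μ ν h)) = 0 := by
  have : cylinder ξ ∩ cylinder (Λ.comp μ ν h) = ∅ := by
    refine Set.subset_eq_empty ?_ (disjoint_cylinder hd hne).inter_eq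
    exact Set.inter_subset_inter_right _ fun x hx => (mem_cylinder_comp.1 hx).1
  rw [inner_chi_chi, this]
  simp

theorem inner_chi_one_of_ne {ν : Λ.Path} {v : Λ.Vertex} (h : v ≠ Λ.range ν) :
    inner ℂ (Λ.chi (Λ.one v)) (Λ.chi ν) = 0 := by
  rw [inner_chi_chi, Set.inter_comm, cylinder_inter_cylinder_one_of_ne h]
  simp

/-- Elements of `span {χ_{[η]} : d(η) = n}` have translates by `μ` in
`span {χ_{[η]} : d(η) = d(μ) + n}`, with the expected inner products. -/
theorem exists_isTranslate (hM : Λ.IsPathMeasure Λ.pathMeasure) (μ : Λ.Path) {n : Fin k → ℕ}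
    {f : Λ.L2} (hf : f ∈ Λ.degreeSpace n) :
    ∃ g ∈ Λ.degreeSpace (Λ.degree μ + n), Λ.IsTranslate μ f g ∧
      inner ℂ (Λ.chi μ) g = (Real.sqrt (Λ.rhoPow (Λ.degree μ)) : ℂ) *
        (((Λ.rhoPow (Λ.degree μ) : ℝ) : ℂ)⁻¹ * inner ℂ (Λ.chi (Λ.one (Λ.source μ))) f) ∧
      ∀ ξ, Λ.degree ξ = Λ.degree μ → ξ ≠ μ → inner ℂ (Λ.chi ξ) g = 0 := by
  -- The inner product formulas are linear in `f` and `g`, so the span induction carries them along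
  -- with membership.
  induction hf using Submodule.span_induction with
  | mem f hf =>
    obtain ⟨ν, hν, rfl⟩ := hf
    rw [Set.mem_ofPred_eq] at hν
    by_cases h : Λ.source μ = Λ.range ν
    · refine ⟨_, Submodule.smul_mem _ _ (Submodule.subset_span ⟨_, ?_, rfl⟩),
        isTranslate_chi hM h, ?_, fun ξ hd hne => ?_⟩
      · rw [Set.mem_ofPred_eq, Λ.degree_comp, hν]
      · rw [inner_smul_right, inner_chi_comp hM]
      · rw [inner_smul_right, inner_chi_comp_of_ne h hd hne, mul_zero]
    · refine ⟨0, Submodule.zero_mem _, isTranslate_chi_of_ne hM h, ?_, fun ξ _ _ => ?_⟩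
      · rw [inner_chi_one_of_ne h, inner_zero_right, mul_zero, mul_zero]
      · rw [inner_zero_right]
  | zero =>
    exact ⟨0, Submodule.zero_mem _, IsTranslate.zero hM μ, by simp, fun ξ _ _ => by simp⟩
  | add f f' _ _ h h' =>
    obtain ⟨g, hg, h1, h2, h3⟩ := h
    obtain ⟨g', hg', h1', h2', h3'⟩ := h'
    refine ⟨g + g', Submodule.add_mem _ hg hg', h1.add hM h1', ?_, fun ξ hd hne => ?_⟩
    · rw [inner_add_right, inner_add_right, h2, h2']
      ring
    · rw [inner_add_right, h3 ξ hd hne, h3' ξ hd hne, add_zero]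
  | smul c f _ h =>
    obtain ⟨g, hg, h1, h2, h3⟩ := h
    refine ⟨c • g, Submodule.smul_mem _ _ hg, h1.smul hM c, ?_, fun ξ hd hne => ?_⟩
    · rw [inner_smul_right, inner_smul_right, h2]
      ring
    · rw [inner_smul_right, h3 ξ hd hne, mul_zero]

/-- Elements of `span {χ_{[η]} : d(η) = m + n}` are sums of translates by the paths of degree `m`
of elements of `span {χ_{[η]} : d(η) = n}`. -/
theorem exists_sum_isTranslate (hM : Λ.IsPathMeasure Λ.pathMeasure) (hρ : ∀ i, 0 < Λ.rho i)
    {m n : Fin k → ℕ} {g : Λ.L2} (hg : g ∈ Λ.degreeSpace (m + n)) :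
    ∃ f h : Λ.Path → Λ.L2, (∀ μ, f μ ∈ Λ.degreeSpace n) ∧
      g = ∑ μ ∈ (IsFinite.finite_degree (Λ := Λ) m).toFinset, h μ ∧
      ∀ μ, Λ.degree μ = m → Λ.IsTranslate μ (f μ) (h μ) ∧
        (Real.sqrt (Λ.rhoPow m) : ℂ) * inner ℂ (Λ.chi μ) g =
          inner ℂ (Λ.chi (Λ.one (Λ.source μ))) (f μ) ∧
        ∀ v, v ≠ Λ.source μ → inner ℂ (Λ.chi (Λ.one v)) (f μ) = 0 := by
  classical
  induction hg using Submodule.span_induction with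
  | mem g hg =>
    obtain ⟨η, hη, rfl⟩ := hg
    rw [Set.mem_ofPred_eq] at hη
    obtain ⟨⟨μ₀, ν⟩, ⟨hμ, hν, h, rfl⟩, -⟩ := Λ.factorization η m n hη
    simp only at hμ hν
    subst hμ hν
    have hpos := rhoPow_pos hρ (Λ.degree μ₀)
    have hs : (Real.sqrt (Λ.rhoPow (Λ.degree μ₀)) : ℂ) ≠ 0 :=
      Complex.ofReal_ne_zero.2 (Real.sqrt_pos.2 hpos).ne'
    -- For `χ_[μ₀ν]` only the prefix `μ₀` contributes; the scalar cancels the factor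
    -- `ρ(Λ)^{d(μ₀)/2}` produced by `S_μ₀`.
    refine ⟨Pi.single μ₀ ((Real.sqrt (Λ.rhoPow (Λ.degree μ₀)) : ℂ)⁻¹ • Λ.chi ν),
      Pi.single μ₀ (Λ.chi (Λ.comp μ₀ ν h)), fun μ => ?_, ?_, fun μ hd => ?_⟩
    · rcases eq_or_ne μ μ₀ with rfl | hne
      · rw [Pi.single_eq_same]
        exact Submodule.smul_mem _ _ (Submodule.subset_span ⟨_, rfl, rfl⟩)
      · rw [Pi.single_eq_of_ne hne]
        exact Submodule.zero_mem _
    · rw [Finset.sum_eq_single μ₀ (fun μ _ hne => Pi.single_eq_of_ne hne _) (by simp),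
        Pi.single_eq_same]
    · rcases eq_or_ne μ μ₀ with rfl | hne
      · rw [Pi.single_eq_same, Pi.single_eq_same]
        refine ⟨?_, ?_, fun v hv => ?_⟩
        · have := (isTranslate_chi hM h).smul hM (Real.sqrt (Λ.rhoPow (Λ.degree μ)) : ℂ)⁻¹
          rwa [smul_smul, inv_mul_cancel₀ hs, one_smul] at this
        · rw [inner_chi_comp hM, inner_smul_right, ← mul_assoc]
          congr 1
          refine eq_inv_of_mul_eq_one_left ?_
          rw [mul_right_comm, ← Complex.ofReal_mul,
            Real.mul_self_sqrt hpos.le, mul_inv_cancel₀ (Complex.ofReal_ne_zero.2 hpos.ne')]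
        · rw [inner_smul_right, inner_chi_one_of_ne (h ▸ hv), mul_zero]
      · rw [Pi.single_eq_of_ne hne, Pi.single_eq_of_ne hne, inner_chi_comp_of_ne h hd hne]
        exact ⟨IsTranslate.zero hM μ, by simp, fun v _ => by simp⟩
  | zero =>
    exact ⟨0, 0, fun μ => Submodule.zero_mem _, by simp, fun μ _ =>
      ⟨IsTranslate.zero hM μ, by simp, fun v _ => by simp⟩⟩
  | add g g' _ _ h h' =>
    obtain ⟨f, h, h1, h2, h3⟩ := h
    obtain ⟨f', h', h1', h2', h3'⟩ := h'
    refine ⟨f + f', h + h', fun μ => Submodule.add_mem _ (h1 μ) (h1' μ), ?_, fun μ hd =>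
      ⟨(h3 μ hd).1.add hM (h3' μ hd).1, ?_, fun v hv => ?_⟩⟩
    · rw [h2, h2', ← Finset.sum_add_distrib]
      rfl
    · rw [inner_add_right, Pi.add_apply, inner_add_right, mul_add, (h3 μ hd).2.1, (h3' μ hd).2.1]
    · rw [Pi.add_apply, inner_add_right, (h3 μ hd).2.2 v hv, (h3' μ hd).2.2 v hv, add_zero]
  | smul c g _ h =>
    obtain ⟨f, h, h1, h2, h3⟩ := h
    refine ⟨c • f, c • h, fun μ => Submodule.smul_mem _ _ (h1 μ), ?_, fun μ hd =>
      ⟨(h3 μ hd).1.smul hM c, ?_, fun v hv => ?_⟩⟩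
    · rw [h2, Finset.smul_sum]
      rfl
    · rw [inner_smul_right, Pi.smul_apply, inner_smul_right, mul_left_comm, (h3 μ hd).2.1]
    · rw [Pi.smul_apply, inner_smul_right, (h3 μ hd).2.2 v hv, mul_zero]

theorem mem_orthogonal_degreeSpace {n : Fin k → ℕ} {f : Λ.L2} :
    f ∈ (Λ.degreeSpace n)ᗮ ↔ ∀ η, Λ.degree η = n → inner ℂ (Λ.chi η) f = 0 := by
  rw [degreeSpace, Submodule.mem_orthogonal]
  constructor
  · exact fun h η hη => h _ (Submodule.subset_span ⟨η, hη, rfl⟩)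
  · intro h u hu
    induction hu using Submodule.span_induction with
    | mem u hu =>
      obtain ⟨η, hη, rfl⟩ := hu
      exact h η hη
    | zero => rw [inner_zero_left]
    | add u v _ _ hu hv => rw [inner_add_left, hu, hv, add_zero]
    | smul c u _ hu => rw [inner_smul_left, hu, mul_zero]

/-- Up to a positive factor, `⟨χ_[μ], g⟩` equals `⟨χ_[s(μ)], f_μ⟩`, where `S_μ f_μ` is the part of
`g` with prefix `μ`. The products of `f_μ` with the other vertex functions vanish, so `g ⟂ 𝒱_q`
forces `f_μ ⟂ 𝒱_0`. Conversely, `S_μ f` with `f ∈ 𝒲_0` is orthogonal to `χ_[μ]` by the same formula,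
and to the other `χ_[ξ]` by disjointness. -/
theorem waveletSpace_eq_span_isTranslate (hM : Λ.IsPathMeasure Λ.pathMeasure)
    (hρ : ∀ i, 0 < Λ.rho i) (q : ℕ) : Λ.waveletSpace q = Submodule.span ℂ
      {g | ∃ η : Λ.Path, (Λ.degree η = fun _ => q) ∧
        ∃ f ∈ Λ.waveletSpace 0, Λ.IsTranslate η f g} := by
  -- Written with `0 + 1` to match the unfolding of `waveletSpace 0`.
  have hdeg : (fun _ => q + 1 : Fin k → ℕ) = (fun _ => q) + fun _ => 0 + 1 := by
    ext; simp
  apply le_antisymm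
  · rintro g ⟨hg, hg'⟩
    change g ∈ Λ.degreeSpace _ at hg
    change g ∈ (Λ.degreeSpace _)ᗮ at hg'
    rw [hdeg] at hg
    obtain ⟨f, h, h1, h2, h3⟩ := exists_sum_isTranslate hM hρ hg
    rw [h2]
    refine Submodule.sum_mem _ fun μ hμ => ?_
    have hd : Λ.degree μ = fun _ => q := by simpa using hμ
    refine Submodule.subset_span ⟨μ, hd, f μ, ⟨h1 μ, ?_⟩, (h3 μ hd).1⟩
    change f μ ∈ (Λ.degreeSpace _)ᗮ
    rw [mem_orthogonal_degreeSpace]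
    intro η hη
    rw [eq_one_of_degree_eq_zero hη]
    by_cases hv : Λ.range η = Λ.source μ
    · rw [hv, ← (h3 μ hd).2.1, mem_orthogonal_degreeSpace.1 hg' μ hd, mul_zero]
    · exact (h3 μ hd).2.2 _ hv
  · refine Submodule.span_le.2 ?_
    rintro g ⟨μ, hd, f, ⟨hf, hf'⟩, hg⟩
    obtain ⟨g', h1, h2, h3, h4⟩ := exists_isTranslate hM μ (n := fun _ => 0 + 1) hf
    obtain rfl := hg.unique h2
    rw [hd, ← hdeg] at h1
    refine ⟨h1, ?_⟩
    change g ∈ (Λ.degreeSpace _)ᗮ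
    change f ∈ (Λ.degreeSpace _)ᗮ at hf'
    rw [mem_orthogonal_degreeSpace] at hf' ⊢
    intro ξ hξ
    by_cases hne : ξ = μ
    · rw [hne, h3, hf' _ (Λ.degree_one _), mul_zero, mul_zero]
    · exact h4 ξ (hξ.trans hd.symm) hne

end Translates

end KGraph

/-! ### Eigenspaces of `D` and the orthogonal decomposition -/

namespace KGraph

variable {k : ℕ}

theorem mem_eigenspace_iff {E : Type*} [AddCommGroup E] [Module ℂ E] {T : E →ₗ.[ℂ] E} {z : ℂ}
    {f : E} : f ∈ eigenspace T z ↔ ∃ h : f ∈ T.domain, T ⟨f, h⟩ = z • f := by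
  simp only [eigenspace, Submodule.mem_map, LinearMap.mem_ker, LinearMap.sub_apply,
    LinearMap.smul_apply, Submodule.subtype_apply, sub_eq_zero]
  constructor
  · rintro ⟨g, hg, rfl⟩
    exact ⟨g.2, hg⟩
  · rintro ⟨h, hf⟩
    exact ⟨⟨f, h⟩, hf, rfl⟩

section Spectral

variable {Λ : KGraph k} [Λ.IsFinite]

theorem prevBoxSpace_le_boxSpace (q : ℕ) : Λ.prevBoxSpace q ≤ Λ.boxSpace q := by
  cases q with
  | zero => exact constSpace_le_boxSpace_zero
  | succ q => exact boxSpace_mono q.le_succ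

theorem boxSpace_le_prevBoxSpace {q r : ℕ} (h : q < r) : Λ.boxSpace q ≤ Λ.prevBoxSpace r := by
  cases r with
  | zero => omega
  | succ r => exact boxSpace_mono (Nat.lt_succ_iff.1 h)

theorem constSpace_le_prevBoxSpace (q : ℕ) : Λ.constSpace ≤ Λ.prevBoxSpace q := by
  cases q with
  | zero => exact le_rfl
  | succ q => exact constSpace_le_boxSpace_zero.trans (boxSpace_mono q.zero_le)

theorem xiDiff_apply (q : ℕ) (f : Λ.L2) : Λ.xiDiff q f =
    (Λ.boxSpace q).starProjection f - (Λ.prevBoxSpace q).starProjection f := rfl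

/-- The difference equals `(f - Ξ_{q-1} f) - (f - Ξ_q f)`, and both terms are orthogonal to
`ℛ_{q-1}`. -/
theorem xiDiff_mem (q : ℕ) (f : Λ.L2) :
    Λ.xiDiff q f ∈ Λ.boxSpace q ⊓ (Λ.prevBoxSpace q)ᗮ := by
  refine ⟨Submodule.sub_mem _ (Submodule.starProjection_apply_mem _ _)
    (prevBoxSpace_le_boxSpace q (Submodule.starProjection_apply_mem _ _)), ?_⟩
  have h1 := Submodule.sub_starProjection_mem_orthogonal (K := Λ.prevBoxSpace q) f
  have h2 := Submodule.orthogonal_le (prevBoxSpace_le_boxSpace q)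
    (Submodule.sub_starProjection_mem_orthogonal (K := Λ.boxSpace q) f)
  have := Submodule.sub_mem _ h1 h2
  rwa [sub_sub_sub_cancel_left] at this

theorem xiDiff_eq_self {q : ℕ} {f : Λ.L2} (hf : f ∈ Λ.boxSpace q ⊓ (Λ.prevBoxSpace q)ᗮ) :
    Λ.xiDiff q f = f := by
  rw [xiDiff_apply, Submodule.starProjection_eq_self_iff.2 hf.1,
    (Submodule.starProjection_apply_eq_zero_iff _).2 hf.2, sub_zero]

theorem xiDiff_eq_zero_of_mem {q : ℕ} {f : Λ.L2} (hf : f ∈ Λ.prevBoxSpace q) :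
    Λ.xiDiff q f = 0 := by
  rw [xiDiff_apply, Submodule.starProjection_eq_self_iff.2 hf,
    Submodule.starProjection_eq_self_iff.2 (prevBoxSpace_le_boxSpace q hf), sub_self]

theorem xiDiff_eq_zero_of_mem_orthogonal {q : ℕ} {f : Λ.L2} (hf : f ∈ (Λ.boxSpace q)ᗮ) :
    Λ.xiDiff q f = 0 := by
  rw [xiDiff_apply, (Submodule.starProjection_apply_eq_zero_iff _).2 hf,
    (Submodule.starProjection_apply_eq_zero_iff _).2
      (Submodule.orthogonal_le (prevBoxSpace_le_boxSpace q) hf), sub_self]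

theorem xiDiff_eq_zero_of_ne {q r : ℕ} (h : r ≠ q) {f : Λ.L2}
    (hf : f ∈ Λ.boxSpace q ⊓ (Λ.prevBoxSpace q)ᗮ) : Λ.xiDiff r f = 0 := by
  rcases lt_or_gt_of_ne h with h | h
  · exact xiDiff_eq_zero_of_mem_orthogonal
      (Submodule.orthogonal_le (boxSpace_le_prevBoxSpace h) hf.2)
  · exact xiDiff_eq_zero_of_mem (boxSpace_le_prevBoxSpace h hf.1)

/-- Vanishing of `Ξ_q f - Ξ_{q-1} f` lifts orthogonality from `ℛ_{q-1}` to `ℛ_q`. Starting from the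
constants, this reaches every `ℛ_q`, and density finishes. -/
theorem eq_zero_of_forall_xiDiff_eq_zero {f : Λ.L2} (hc : f ∈ Λ.constSpaceᗮ)
    (h : ∀ q, Λ.xiDiff q f = 0) : f = 0 := by
  have step : ∀ q, f ∈ (Λ.prevBoxSpace q)ᗮ → f ∈ (Λ.boxSpace q)ᗮ := by
    intro q hq
    rw [← Submodule.starProjection_apply_eq_zero_iff] at hq ⊢
    have := h q
    rwa [xiDiff_apply, hq, sub_zero] at this
  have hbox : ∀ q, f ∈ (Λ.boxSpace q)ᗮ := by
    intro q
    induction q with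
    | zero => exact step 0 hc
    | succ q ih => exact step (q + 1) ih
  exact eq_zero_of_forall_mem_boxSpace_orthogonal f hbox

variable {α : ℕ → ℝ} {z : ℂ} {f : Λ.L2}

theorem hasSum_of_mem_eigenspace_dirac (hf : f ∈ eigenspace (Λ.dirac α) z) :
    HasSum (fun q => (α q : ℂ) • Λ.xiDiff q f) (z • f) := by
  obtain ⟨h, e⟩ := mem_eigenspace_iff.1 hf
  rw [← e]
  exact Summable.hasSum h

theorem mem_eigenspace_dirac_of_hasSum
    (h : HasSum (fun q => (α q : ℂ) • Λ.xiDiff q f) (z • f)) :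
    f ∈ eigenspace (Λ.dirac α) z :=
  mem_eigenspace_iff.2 ⟨h.summable, h.tsum_eq⟩

/-- Applying the bounded operator `Ξ_r - Ξ_{r-1}` term by term to the series for `zf` keeps only the
term `q = r`, so `α_r` and `z` act alike on that component. -/
theorem xiDiff_eq_zero_of_mem_eigenspace (hf : f ∈ eigenspace (Λ.dirac α) z) {r : ℕ}
    (hz : z ≠ α r) : Λ.xiDiff r f = 0 := by
  have h1 := (hasSum_of_mem_eigenspace_dirac hf).mapL (Λ.xiDiff r)
  have h2 := h1.unique (hasSum_single r fun q hq => by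
    rw [map_smul, xiDiff_eq_zero_of_ne hq.symm (xiDiff_mem q f), smul_zero])
  rw [map_smul, map_smul, xiDiff_eq_self (xiDiff_mem r f), ← sub_eq_zero, ← sub_smul] at h2
  exact (smul_eq_zero.1 h2).resolve_left (sub_ne_zero.2 hz)

theorem mem_orthogonal_constSpace_of_mem_eigenspace (hf : f ∈ eigenspace (Λ.dirac α) z)
    (hz : z ≠ 0) : f ∈ Λ.constSpaceᗮ := by
  rw [← Submodule.starProjection_apply_eq_zero_iff]
  have h1 := (hasSum_of_mem_eigenspace_dirac hf).mapL Λ.constSpace.starProjection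
  have h2 : ∀ q, Λ.constSpace.starProjection ((α q : ℂ) • Λ.xiDiff q f) = 0 := fun q => by
    rw [map_smul, (Submodule.starProjection_apply_eq_zero_iff _).2
      (Submodule.orthogonal_le (constSpace_le_prevBoxSpace q) (xiDiff_mem q f).2), smul_zero]
  simp only [h2] at h1
  have h3 := h1.unique hasSum_zero
  rw [map_smul] at h3
  exact (smul_eq_zero.1 h3).resolve_left hz

theorem eigenspace_dirac_eq_bot (h0 : z ≠ 0) (hz : ∀ q, z ≠ α q) :
    eigenspace (Λ.dirac α) z = ⊥ := by
  refine (Submodule.eq_bot_iff _).2 fun f hf => ?_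
  exact eq_zero_of_forall_xiDiff_eq_zero (mem_orthogonal_constSpace_of_mem_eigenspace hf h0)
    fun q => xiDiff_eq_zero_of_mem_eigenspace hf (hz q)

theorem eigenspace_dirac_zero (hα : ∀ q, α q ≠ 0) :
    eigenspace (Λ.dirac α) 0 = Λ.constSpace := by
  apply le_antisymm
  · intro f hf
    have h1 : f - Λ.constSpace.starProjection f = 0 := by
      refine eq_zero_of_forall_xiDiff_eq_zero
        (Submodule.sub_starProjection_mem_orthogonal f) fun q => ?_
      rw [map_sub, xiDiff_eq_zero_of_mem_eigenspace hf
        (Complex.ofReal_ne_zero.2 (hα q)).symm, xiDiff_eq_zero_of_mem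
        (constSpace_le_prevBoxSpace q (Submodule.starProjection_apply_mem _ _)), sub_zero]
    rw [sub_eq_zero.1 h1]
    exact Submodule.starProjection_apply_mem _ _
  · intro f hf
    refine mem_eigenspace_dirac_of_hasSum ?_
    simp only [xiDiff_eq_zero_of_mem (constSpace_le_prevBoxSpace _ hf), smul_zero, zero_smul]
    exact hasSum_zero

/-- Subtracting from an eigenvector its `q`-th component leaves a vector with no component at all,
hence 0. -/
theorem eigenspace_dirac_apply (hα : ∀ q, α q ≠ 0) (hinj : Function.Injective α) (q : ℕ) :
    eigenspace (Λ.dirac α) (α q) = Λ.boxSpace q ⊓ (Λ.prevBoxSpace q)ᗮ := by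
  apply le_antisymm
  · intro f hf
    have h1 : f - Λ.xiDiff q f = 0 := by
      refine eq_zero_of_forall_xiDiff_eq_zero (Submodule.sub_mem _
        (mem_orthogonal_constSpace_of_mem_eigenspace hf (Complex.ofReal_ne_zero.2 (hα q)))
        (Submodule.orthogonal_le (constSpace_le_prevBoxSpace q) (xiDiff_mem q f).2)) fun r => ?_
      rcases eq_or_ne r q with rfl | hr
      · rw [map_sub, xiDiff_eq_self (xiDiff_mem r f), sub_self]
      · rw [map_sub, xiDiff_eq_zero_of_ne hr (xiDiff_mem q f), sub_zero]
        exact xiDiff_eq_zero_of_mem_eigenspace hf fun h => hr (hinj (Complex.ofReal_inj.1 h)).symm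
    rw [sub_eq_zero.1 h1]
    exact xiDiff_mem q f
  · intro f hf
    refine mem_eigenspace_dirac_of_hasSum ?_
    conv => arg 2; rw [← xiDiff_eq_self hf]
    exact hasSum_single q fun r hr => by rw [xiDiff_eq_zero_of_ne hr hf, smul_zero]

theorem waveletSpace_eq_boxSpace (q : ℕ) :
    Λ.waveletSpace q = Λ.boxSpace (q + 1) ⊓ (Λ.boxSpace q)ᗮ := by
  rw [waveletSpace, boxSpace_eq_scalingSpace, boxSpace_eq_scalingSpace]

theorem waveletSummand_le_boxSpace (n : ℕ) : Λ.waveletSummand n ≤ Λ.boxSpace n := by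
  cases n with
  | zero => exact (boxSpace_eq_scalingSpace 0).ge
  | succ q => exact (waveletSpace_eq_boxSpace q).trans_le inf_le_left

theorem waveletSummand_le_orthogonal {m n : ℕ} (h : m < n) :
    Λ.waveletSummand n ≤ (Λ.boxSpace m)ᗮ := by
  cases n with
  | zero => omega
  | succ q =>
    exact (waveletSpace_eq_boxSpace q).trans_le
      (inf_le_right.trans (Submodule.orthogonal_le (boxSpace_mono (Nat.lt_succ_iff.1 h))))

instance (n : ℕ) : FiniteDimensional ℂ (Λ.waveletSummand n) :=
  Submodule.finiteDimensional_of_le (waveletSummand_le_boxSpace n)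

theorem isHilbertSum_waveletSummand : IsHilbertSum ℂ (fun n => Λ.waveletSummand n)
    (fun n => (Λ.waveletSummand n).subtypeₗᵢ) := by
  have : ∀ n, CompleteSpace (Λ.waveletSummand n) := fun n => FiniteDimensional.complete ℂ _
  refine IsHilbertSum.mkInternal _ ?_ ?_
  · refine OrthogonalFamily.of_pairwise fun m n hmn => ?_
    have key : ∀ {m n}, m < n → Λ.waveletSummand m ⟂ Λ.waveletSummand n := fun h =>
      (Submodule.isOrtho_orthogonal_right _).mono (waveletSummand_le_boxSpace _)
        (waveletSummand_le_orthogonal h)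
    rcases lt_or_gt_of_ne hmn with h | h
    · exact key h
    · exact (key h).symm
  · rw [top_le_iff, Submodule.topologicalClosure_eq_top_iff, Submodule.eq_bot_iff]
    intro f hf
    have hs : ∀ n, f ∈ (Λ.waveletSummand n)ᗮ := fun n =>
      Submodule.orthogonal_le (le_iSup Λ.waveletSummand n) hf
    refine eq_zero_of_forall_mem_boxSpace_orthogonal f fun n => ?_
    induction n with
    | zero =>
      rw [boxSpace_eq_scalingSpace]
      exact hs 0
    | succ n ih =>
      -- Since `ℛ_{n+1} = ℛ_n ⊕ 𝒲_n`, orthogonality to both summands climbs one level.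
      rw [← Submodule.sup_orthogonal_inf_of_hasOrthogonalProjection 
        (boxSpace_mono (Nat.le_add_right n 1)), ← Submodule.inf_orthogonal,
        inf_comm (Λ.boxSpace n)ᗮ (Λ.boxSpace (n + 1)), ← waveletSpace_eq_boxSpace]
      exact ⟨ih, hs (n + 1)⟩

end Spectral

end KGraph

/-! ### Perron's theorem and the spectral radius -/

section PerronFrobenius

variable {n : Type*} [Fintype n]

/-- **Perron's theorem** for a strictly positive operator `L`: it has a positive eigenvector, and
the eigenspace of this vector is one-dimensional. -/
theorem LinearMap.exists_pos_eigenvector [Nonempty n] (L : (n → ℝ) →ₗ[ℝ] (n → ℝ))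
    (hL : ∀ z : n → ℝ, 0 ≤ z → z ≠ 0 → ∀ i, 0 < L z i) :
    ∃ (x : n → ℝ) (r : ℝ), (∀ i, 0 < x i) ∧ L x = r • x ∧
      ∀ y, L y = r • y → ∃ c : ℝ, y = c • x := by
  have hcont : Continuous L := L.continuous_of_finiteDimensional
  have hsimp : ∀ z ∈ stdSimplex ℝ n, 0 ≤ z ∧ z ≠ 0 := by
    refine fun z hz => ⟨hz.1, ?_⟩
    rintro rfl
    simpa using hz.2
  have hne : (stdSimplex ℝ n).Nonempty := by
    classical
    obtain ⟨i⟩ := ‹Nonempty n›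
    exact ⟨_, single_mem_stdSimplex ℝ i⟩
  obtain ⟨C, hC⟩ : ∃ C, ∀ z ∈ stdSimplex ℝ n, ∑ i, L z i ≤ C := by
    obtain ⟨w, -, hw⟩ := (isCompact_stdSimplex ℝ n).exists_isMaxOn hne
      (f := fun z => ∑ i, L z i) (by fun_prop)
    exact ⟨_, hw⟩
  have hbound : ∀ z ∈ stdSimplex ℝ n, ∀ t : ℝ, (∀ i, t * z i ≤ L z i) → t ≤ C := by
    intro z hz t ht
    calc t = ∑ i, t * z i := by rw [← Finset.mul_sum, hz.2, mul_one]
      _ ≤ _ := Finset.sum_le_sum fun i _ => ht i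
      _ ≤ C := hC z hz
  -- Collatz–Wielandt: maximize `r` subject to `r x ≤ L x` with `x` in the simplex. Summing
  -- coordinates bounds `r` by `C`, so `S` is compact.
  let S : Set (ℝ × (n → ℝ)) :=
    (Set.Icc 0 C ×ˢ stdSimplex ℝ n) ∩ {p | ∀ i, p.1 * p.2 i ≤ L p.2 i}
  have hS : IsCompact S := by
    refine (isCompact_Icc.prod (isCompact_stdSimplex ℝ n)).inter_right ?_
    rw [Set.ofPred_forall]
    refine isClosed_iInter fun i => isClosed_le (by fun_prop) (by fun_prop)
  have hSne : S.Nonempty := by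
    obtain ⟨z, hz⟩ := hne
    have h0 : ∀ i, 0 * z i ≤ L z i := fun i => by
      rw [zero_mul]
      exact (hL z (hsimp z hz).1 (hsimp z hz).2 i).le
    exact ⟨(0, z), ⟨⟨le_rfl, hbound z hz 0 h0⟩, hz⟩, h0⟩
  obtain ⟨⟨r, x⟩, ⟨⟨⟨hr, -⟩, hx⟩, hle⟩, hmax⟩ :=
    hS.exists_isMaxOn hSne (f := Prod.fst) continuous_fst.continuousOn
  simp only at hr hx
  obtain ⟨hx0, hxne⟩ := hsimp x hx
  have hLx : ∀ i, 0 < L x i := hL x hx0 hxne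
  have heig : L x = r • x := by
    -- If `L x ≠ r x`, then `L (L x - r x)` is strictly positive, and the normalization of `L x`
    -- satisfies the constraint with `r + ε`, against maximality.
    by_contra hneq
    have hz0 : 0 ≤ L x - r • x := fun i => sub_nonneg.2 (hle i)
    have hz := hL _ hz0 (sub_ne_zero.2 hneq)
    obtain ⟨ε, hε, hεle⟩ : ∃ ε : ℝ, 0 < ε ∧ ∀ i, ε * L x i ≤ L (L x - r • x) i := by
      obtain ⟨i₀, -, hi₀⟩ := Finset.univ.exists_min_image
        (fun i => L (L x - r • x) i / L x i) Finset.univ_nonempty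
      exact ⟨_, div_pos (hz i₀) (hLx i₀), fun i => (le_div_iff₀ (hLx i)).1
        (hi₀ i (Finset.mem_univ i))⟩
    have hs : 0 < ∑ i, L x i := Finset.sum_pos (fun i _ => hLx i) Finset.univ_nonempty
    have hy : (∑ i, L x i)⁻¹ • L x ∈ stdSimplex ℝ n := by
      refine ⟨fun i => mul_nonneg (inv_nonneg.2 hs.le) (hLx i).le, ?_⟩
      simp only [Pi.smul_apply, smul_eq_mul]
      rw [← Finset.mul_sum, inv_mul_cancel₀ hs.ne']
    have hyle : ∀ i, (r + ε) * ((∑ i, L x i)⁻¹ • L x) i ≤ L ((∑ i, L x i)⁻¹ • L x) i := by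
      intro i
      have h1 := hεle i
      simp only [map_sub, map_smul, Pi.sub_apply, Pi.smul_apply, smul_eq_mul] at h1 ⊢
      rw [mul_left_comm]
      refine mul_le_mul_of_nonneg_left ?_ (inv_nonneg.2 hs.le)
      linarith
    have hmem : (r + ε, (∑ i, L x i)⁻¹ • L x) ∈ S :=
      ⟨⟨⟨by linarith, hbound _ hy _ hyle⟩, hy⟩, hyle⟩
    have := hmax hmem
    simp only [Set.mem_ofPred_eq] at this
    linarith
  have hxpos : ∀ i, 0 < x i := fun i => (hx0 i).lt_of_ne' fun h => by
    have := hLx i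
    rw [heig, Pi.smul_apply, h, Pi.zero_apply, smul_zero] at this
    exact this.false
  refine ⟨x, r, hxpos, heig, fun y hy => ?_⟩
  -- Subtracting the minimal ratio times `x` leaves `w ≥ 0` with `L w = r w` and `w i₀ = 0`. If `w ≠
  -- 0`, positivity of `L w` at `i₀` is contradicted.
  obtain ⟨i₀, -, hi₀⟩ := Finset.univ.exists_min_image (fun i => y i / x i) Finset.univ_nonempty
  refine ⟨y i₀ / x i₀, ?_⟩
  by_contra hneq
  have hw0 : 0 ≤ y - (y i₀ / x i₀) • x := fun i =>
    sub_nonneg.2 ((le_div_iff₀ (hxpos i)).1 (hi₀ i (Finset.mem_univ i)))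
  have := hL _ hw0 (sub_ne_zero.2 hneq) i₀
  rw [map_sub, map_smul, heig, hy, smul_comm, ← smul_sub, Pi.smul_apply, Pi.sub_apply,
    Pi.smul_apply, smul_eq_mul, smul_eq_mul, div_mul_cancel₀ _ (hxpos i₀).ne', sub_self,
    mul_zero] at this
  exact this.false

/-- The spectral radius of a nonnegative matrix with a positive eigenvector is its eigenvalue. -/
theorem Matrix.spectralRadius_eq_of_mulVec_eq [DecidableEq n] [Nonempty n] (A : Matrix n n ℕ)
    {x : n → ℝ} (hx : ∀ i, 0 < x i) {c : ℝ}
    (h : (A.map fun m : ℕ => (m : ℝ)).mulVec x = c • x) :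
    spectralRadius ℂ (A.map fun m : ℕ => (m : ℂ)) = ENNReal.ofReal c := by
  have hi : ∀ i, ∑ j, (A i j : ℝ) * x j = c * x i := fun i => congrFun h i
  have hc : 0 ≤ c := by
    obtain ⟨i⟩ := ‹Nonempty n›
    refine nonneg_of_mul_nonneg_left ?_ (hx i)
    rw [← hi i]
    exact Finset.sum_nonneg fun j _ => mul_nonneg (Nat.cast_nonneg _) (hx j).le
  have hspec : ∀ z : ℂ, z ∈ spectrum ℂ (A.map fun m : ℕ => (m : ℂ)) ↔
      ∃ y : n → ℂ, y ≠ 0 ∧ (A.map fun m : ℕ => (m : ℂ)).mulVec y = z • y := by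
    intro z
    rw [← Matrix.spectrum_toLin', ← Module.End.hasEigenvalue_iff_mem_spectrum]
    constructor
    · intro hz
      obtain ⟨y, hy⟩ := hz.exists_hasEigenvector
      exact ⟨y, hy.2, by simpa using hy.apply_eq_smul⟩
    · rintro ⟨y, hy, e⟩
      exact Module.End.hasEigenvalue_of_hasEigenvector (x := y)
        ⟨Module.End.mem_eigenspace_iff.2 (by simpa using e), hy⟩
  apply le_antisymm
  · refine iSup₂_le fun z hz => ?_
    obtain ⟨y, hy, e⟩ := (hspec z).1 hz
    -- In the maximum norm weighted by `x`, the matrix has norm at most `c`; the eigenvalue equation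
    -- is read at the maximizing coordinate.
    obtain ⟨i, -, himax⟩ := Finset.univ.exists_max_image (fun i => ‖y i‖ / x i)
      Finset.univ_nonempty
    have hle : ∀ j, ‖y j‖ ≤ ‖y i‖ / x i * x j := fun j =>
      (div_le_iff₀ (hx j)).1 (himax j (Finset.mem_univ j))
    have hyi : 0 < ‖y i‖ := by
      refine (norm_nonneg _).lt_of_ne' fun h0 => hy (funext fun j => ?_)
      have := hle j
      rw [h0, zero_div, zero_mul] at this
      exact norm_le_zero_iff.1 this
    have hzi : ∑ j, (A i j : ℂ) * y j = z * y i := congrFun e i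
    have : ‖z‖ * ‖y i‖ ≤ c * ‖y i‖ := by
      calc ‖z‖ * ‖y i‖ = ‖∑ j, (A i j : ℂ) * y j‖ := by rw [hzi, norm_mul]
        _ ≤ ∑ j, ‖(A i j : ℂ) * y j‖ := norm_sum_le _ _
        _ ≤ ∑ j, ‖y i‖ / x i * ((A i j : ℝ) * x j) := by
          refine Finset.sum_le_sum fun j _ => ?_
          rw [norm_mul, Complex.norm_natCast, mul_left_comm]
          exact mul_le_mul_of_nonneg_left (hle j) (Nat.cast_nonneg _)
        _ = c * ‖y i‖ := by
          rw [← Finset.mul_sum, hi]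
          field_simp [(hx i).ne']
    rw [← enorm_eq_nnnorm, ← ofReal_norm]
    exact ENNReal.ofReal_le_ofReal (le_of_mul_le_mul_right this hyi)
  · have hmem : (c : ℂ) ∈ spectrum ℂ (A.map fun m : ℕ => (m : ℂ)) := by
      refine (hspec c).2 ⟨fun i => (x i : ℂ), fun h0 => ?_, funext fun i => ?_⟩
      · obtain ⟨i⟩ := ‹Nonempty n›
        exact (hx i).ne' (Complex.ofReal_eq_zero.1 (congrFun h0 i))
      · have := congrArg (fun t : ℝ => (t : ℂ)) (hi i)
        push_cast at this
        exact this
    refine le_trans (le_of_eq ?_) (le_iSup₂ (f := fun z (_ : z ∈ spectrum ℂ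
      (A.map fun m : ℕ => (m : ℂ))) => (‖z‖₊ : ℝ≥0∞)) (c : ℂ) hmem)
    rw [← enorm_eq_nnnorm, ← ofReal_norm, Complex.norm_real, Real.norm_of_nonneg hc]

end PerronFrobenius

/-! ### Transfer operators and the Perron–Frobenius vector of a graph -/

namespace KGraph

variable {k : ℕ}

/-- `Λ` has no sources: every vertex receives paths of every degree `e_i`. -/
def NoSources (Λ : KGraph k) : Prop :=
  ∀ (v : Λ.Vertex) (i : Fin k), ∃ η : Λ.Path, Λ.degree η = Pi.single i 1 ∧ Λ.range η = v

section Transfer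

variable {Λ : KGraph k} [Λ.IsFinite]

/-- The finite set `vΛ^n` of paths of degree `n` with range `v`. -/
noncomputable def pathsFrom (Λ : KGraph k) [Λ.IsFinite] (v : Λ.Vertex) (n : Fin k → ℕ) :
    Finset Λ.Path :=
  (finite_degree_and n fun η => Λ.range η = v).toFinset

theorem mem_pathsFrom {v : Λ.Vertex} {n : Fin k → ℕ} {η : Λ.Path} :
    η ∈ Λ.pathsFrom v n ↔ Λ.degree η = n ∧ Λ.range η = v := by
  simp [pathsFrom]

/-- The operator `(T_n x)(v) = ∑_{η ∈ vΛ^n} x(s(η))`. -/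
noncomputable def transfer (Λ : KGraph k) [Λ.IsFinite] (n : Fin k → ℕ) :
    (Λ.Vertex → ℝ) →ₗ[ℝ] (Λ.Vertex → ℝ) where
  toFun x v := ∑ η ∈ Λ.pathsFrom v n, x (Λ.source η)
  map_add' x y := funext fun v => by simp [Finset.sum_add_distrib]
  map_smul' c x := funext fun v => by simp [Finset.mul_sum]

theorem transfer_apply (n : Fin k → ℕ) (x : Λ.Vertex → ℝ) (v : Λ.Vertex) :
    Λ.transfer n x v = ∑ η ∈ Λ.pathsFrom v n, x (Λ.source η) := rfl

/-- Factorization matches the paths of degree `m + n` with composable pairs. This gives `T_{m+n} =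
T_m T_n`, so the transfer operators commute. -/
theorem sum_pathsFrom_add (v : Λ.Vertex) (m n : Fin k → ℕ) (g : Λ.Path → ℝ) :
    ∑ η ∈ Λ.pathsFrom v (m + n), g (drop η m) =
      ∑ μ ∈ Λ.pathsFrom v m, ∑ ν ∈ Λ.pathsFrom (Λ.source μ) n, g ν := by
  rw [Finset.sum_sigma']
  refine Finset.sum_bij' (fun η _ => (⟨take η m, drop η m⟩ : Σ _ : Λ.Path, Λ.Path))
    (fun p hp => Λ.comp p.1 p.2 ?_) ?_ ?_ ?_ ?_ ?_
  · rw [Finset.mem_sigma, mem_pathsFrom, mem_pathsFrom] at hp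
    exact hp.2.2.symm
  · intro η hη
    rw [mem_pathsFrom] at hη
    have hm : m ≤ Λ.degree η := by rw [hη.1]; exact le_self_add
    rw [Finset.mem_sigma, mem_pathsFrom, mem_pathsFrom, degree_take hm, range_take hm,
      degree_drop hm, source_take hm, hη.1, add_tsub_cancel_left]
    exact ⟨⟨rfl, hη.2⟩, rfl, rfl⟩
  · rintro ⟨μ, ν⟩ hp
    rw [Finset.mem_sigma, mem_pathsFrom, mem_pathsFrom] at hp
    rw [mem_pathsFrom, Λ.degree_comp, Λ.range_comp, hp.1.1, hp.2.1]
    exact ⟨rfl, hp.1.2⟩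
  · intro η hη
    rw [mem_pathsFrom] at hη
    exact comp_take_drop (by rw [hη.1]; exact le_self_add)
  · rintro ⟨μ, ν⟩ hp
    rw [Finset.mem_sigma, mem_pathsFrom, mem_pathsFrom] at hp
    have hs : Λ.source μ = Λ.range ν := hp.2.2.symm
    have := take_drop_comp μ ν hs
    rw [hp.1.1] at this
    rw [this.1, this.2]
  · intro η _
    rfl

theorem transfer_add (m n : Fin k → ℕ) (x : Λ.Vertex → ℝ) :
    Λ.transfer (m + n) x = Λ.transfer m (Λ.transfer n x) := by
  funext v
  simp only [transfer_apply]
  rw [← sum_pathsFrom_add v m n fun ν => x (Λ.source ν)]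
  refine Finset.sum_congr rfl fun η hη => ?_
  rw [source_drop]
  rw [(mem_pathsFrom.1 hη).1]
  exact le_self_add

theorem pathsFrom_zero (v : Λ.Vertex) : Λ.pathsFrom v 0 = {Λ.one v} := by
  ext η
  rw [mem_pathsFrom, Finset.mem_singleton]
  constructor
  · rintro ⟨h1, rfl⟩
    exact eq_one_of_degree_eq_zero h1
  · rintro rfl
    exact ⟨Λ.degree_one v, Λ.range_one v⟩

theorem transfer_zero (x : Λ.Vertex → ℝ) : Λ.transfer 0 x = x := by
  funext v
  rw [transfer_apply, pathsFrom_zero, Finset.sum_singleton, Λ.source_one]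

theorem adjacency_mulVec (i : Fin k) (x : Λ.Vertex → ℝ) :
    ((Λ.adjacency i).map (fun n : ℕ => (n : ℝ))).mulVec x = Λ.transfer (Pi.single i 1) x := by
  classical
  funext v
  rw [transfer_apply, ← Finset.sum_fiberwise _ Λ.source]
  refine Finset.sum_congr rfl fun w _ => ?_
  rw [Finset.sum_congr rfl fun η hη => by rw [(Finset.mem_filter.1 hη).2], Finset.sum_const,
    nsmul_eq_mul]
  change (Λ.adjacency i v w : ℝ) * x w = _
  congr 2
  rw [← Nat.card_eq_finsetCard]
  refine Nat.card_congr (Equiv.subtypeEquivRight fun η => ?_)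
  rw [Finset.mem_filter, mem_pathsFrom, and_assoc]

theorem transfer_nonneg {x : Λ.Vertex → ℝ} (hx : 0 ≤ x) (n : Fin k → ℕ) :
    0 ≤ Λ.transfer n x :=
  fun _ => Finset.sum_nonneg fun _ _ => hx _

/-- A single `A_i` may be reducible. Choosing a path between each pair of vertices and summing `T_n`
over their degrees gives a strictly positive `L`. Each `T_{e_i}` commutes with `L`, so it preserves
the line of Perron eigenvectors; its eigenvalue there is `ρ_i` because the vector is positive. -/
theorem exists_isPerronFrobenius [Nonempty Λ.Vertex] (hΛ : Λ.StronglyConnected) :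
    ∃ x, Λ.IsPerronFrobenius x := by
  classical
  choose η hr hs using hΛ
  let F : Finset (Fin k → ℕ) :=
    Finset.univ.image fun p : Λ.Vertex × Λ.Vertex => Λ.degree (η p.1 p.2)
  let L : (Λ.Vertex → ℝ) →ₗ[ℝ] (Λ.Vertex → ℝ) := ∑ n ∈ F, Λ.transfer n
  have hLapp : ∀ z, L z = ∑ n ∈ F, Λ.transfer n z := fun z => by
    simp only [L, LinearMap.sum_apply]
  have hL : ∀ z : Λ.Vertex → ℝ, 0 ≤ z → z ≠ 0 → ∀ v, 0 < L z v := by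
    intro z hz hne v
    obtain ⟨w, hw⟩ := Function.ne_iff.1 hne
    have hw' : 0 < z w := (hz w).lt_of_ne' hw
    rw [hLapp, Finset.sum_apply]
    refine Finset.sum_pos' (fun n _ => transfer_nonneg hz n v) ⟨Λ.degree (η v w),
      Finset.mem_image.2 ⟨(v, w), Finset.mem_univ _, rfl⟩, ?_⟩
    refine Finset.sum_pos' (fun _ _ => hz _) ⟨η v w, mem_pathsFrom.2 ⟨rfl, hr v w⟩, ?_⟩
    rwa [hs]
  obtain ⟨x, r, hx, hxr, huniq⟩ := L.exists_pos_eigenvector hL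
  have hsum : 0 < ∑ v, x v := Finset.sum_pos (fun v _ => hx v) Finset.univ_nonempty
  have hA : ∀ i, ((Λ.adjacency i).map (fun n : ℕ => (n : ℝ))).mulVec x = Λ.rho i • x := by
    intro i
    obtain ⟨c, hc⟩ := huniq (Λ.transfer (Pi.single i 1) x) (by
      rw [← map_smul, ← hxr, hLapp, hLapp, map_sum]
      refine Finset.sum_congr rfl fun n _ => ?_
      rw [← transfer_add, ← transfer_add, add_comm])
    have h1 : ((Λ.adjacency i).map (fun n : ℕ => (n : ℝ))).mulVec x = c • x := by
      rw [adjacency_mulVec, hc]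
    have hc0 : 0 ≤ c := by
      obtain ⟨v⟩ := ‹Nonempty Λ.Vertex›
      refine nonneg_of_mul_nonneg_left ?_ (hx v)
      have := transfer_nonneg (fun v => (hx v).le) (Pi.single i 1) v
      rwa [hc] at this
    rw [h1, rho, Matrix.spectralRadius_eq_of_mulVec_eq _ hx h1, ENNReal.toReal_ofReal hc0]
  refine ⟨(∑ v, x v)⁻¹ • x, fun v => mul_pos (inv_pos.2 hsum) (hx v), ?_, fun i => ?_⟩
  · simp only [Pi.smul_apply, smul_eq_mul]
    rw [← Finset.mul_sum, inv_mul_cancel₀ hsum.ne']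
  · rw [Matrix.mulVec_smul, hA, smul_comm]

theorem isPerronFrobenius_perronVector [Nonempty Λ.Vertex] (hΛ : Λ.StronglyConnected) :
    Λ.IsPerronFrobenius Λ.perronVector := by
  have h := exists_isPerronFrobenius hΛ
  rw [perronVector, dif_pos h]
  exact h.choose_spec

theorem IsPerronFrobenius.rho_pos [Nonempty Λ.Vertex] {x : Λ.Vertex → ℝ}
    (hx : Λ.IsPerronFrobenius x) (hs : Λ.NoSources) (i : Fin k) : 0 < Λ.rho i := by
  obtain ⟨v⟩ := ‹Nonempty Λ.Vertex›
  obtain ⟨η, h1, h2⟩ := hs v i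
  refine pos_of_mul_pos_left ?_ (hx.1 v).le
  have := congrFun ((adjacency_mulVec i x).symm.trans (hx.2.2 i)) v
  rw [Pi.smul_apply, smul_eq_mul] at this
  rw [← this]
  exact Finset.sum_pos (fun _ _ => hx.1 _) ⟨η, mem_pathsFrom.2 ⟨h1, h2⟩⟩

/-- The degrees `n` satisfying this form a submonoid containing each `e_i`. -/
theorem IsPerronFrobenius.transfer_eq {x : Λ.Vertex → ℝ} (hx : Λ.IsPerronFrobenius x)
    (n : Fin k → ℕ) : Λ.transfer n x = Λ.rhoPow n • x := by
  let S : AddSubmonoid (Fin k → ℕ) :=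
    { carrier := {n | Λ.transfer n x = Λ.rhoPow n • x}
      zero_mem' := by
        change Λ.transfer 0 x = Λ.rhoPow 0 • x
        rw [transfer_zero, rhoPow_zero, one_smul]
      add_mem' := by
        intro m n (hm : Λ.transfer m x = _) (hn : Λ.transfer n x = _)
        change Λ.transfer (m + n) x = _
        rw [transfer_add, hn, map_smul, hm, smul_smul, rhoPow_add, mul_comm] }
  have hsingle : ∀ i, Pi.single i 1 ∈ S := by
    intro i
    change Λ.transfer _ x = _
    rw [← adjacency_mulVec, hx.2.2, rhoPow, Finset.prod_eq_single i]
    · simp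
    · intro j _ hj
      rw [Pi.single_eq_of_ne hj, pow_zero]
    · simp
  have : n ∈ S := by
    rw [pi_eq_sum_univ' n]
    exact S.sum_mem fun i _ => S.nsmul_mem (by simpa using hsingle i) _
  exact this

end Transfer

end KGraph

/-! ### Cutting subsets of the unit interval to prescribed measure -/

section Splitting

/-- Lebesgue measure on the unit interval, as a measure on `ℝ`. -/
noncomputable def unitMeasure : Measure ℝ := volume.restrict (Set.Icc 0 1)

instance : IsProbabilityMeasure unitMeasure := ⟨by simp [unitMeasure]⟩

/-- The measure of `E ∩ (-∞, t]` is 1-Lipschitz in `t`, so the intermediate value theorem gives a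
cut of any admissible measure. -/
theorem exists_subset_unitMeasure_eq {E : Set ℝ} (hE : MeasurableSet E) {a : ℝ≥0∞}
    (ha : a ≤ unitMeasure E) : ∃ F ⊆ E, MeasurableSet F ∧ unitMeasure F = a := by
  have hstep : ∀ s t, s ≤ t →
      unitMeasure (E ∩ Set.Iic t) ≤ unitMeasure (E ∩ Set.Iic s) + ENNReal.ofReal (t - s) := by
    intro s t hst
    have h1 : E ∩ Set.Iic t ⊆ (E ∩ Set.Iic s) ∪ Set.Ioc s t := by
      rintro y ⟨hy, hyt⟩
      rcases le_or_gt y s with h | h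
      · exact Or.inl ⟨hy, h⟩
      · exact Or.inr ⟨h, hyt⟩
    refine (measure_mono h1).trans ((measure_union_le _ _).trans ?_)
    gcongr
    rw [← Real.volume_Ioc]
    exact Measure.restrict_apply_le _ _
  let g : ℝ → ℝ := fun t => unitMeasure.real (E ∩ Set.Iic t)
  have hmono : Monotone g := fun s t hst =>
    measureReal_mono (Set.inter_subset_inter_right _ (Set.Iic_subset_Iic.2 hst))
  have hg : LipschitzWith 1 g := by
    refine LipschitzWith.of_le_add fun t s => ?_
    rcases le_total t s with h | h
    · exact (hmono h).trans (le_add_of_nonneg_right dist_nonneg)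
    · have := ENNReal.toReal_mono (by finiteness) (hstep s t h)
      rw [ENNReal.toReal_add (by finiteness) (by finiteness),
        ENNReal.toReal_ofReal (sub_nonneg.2 h)] at this
      rwa [Real.dist_eq, abs_of_nonneg (sub_nonneg.2 h)]
  have h0 : g 0 = 0 := by
    have : unitMeasure (Set.Iic 0) = 0 := by
      rw [unitMeasure, Measure.restrict_apply measurableSet_Iic]
      refine measure_mono_null (t := {0}) (fun y hy => le_antisymm hy.1 hy.2.1) (by simp)
    exact (measureReal_eq_zero_iff).2 (measure_mono_null Set.inter_subset_right this)
  have h1 : g 1 = unitMeasure.real E := by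
    refine measureReal_congr ?_
    have : ∀ᵐ y ∂unitMeasure, y ∈ Set.Icc (0 : ℝ) 1 := ae_restrict_mem measurableSet_Icc
    filter_upwards [this] with y hy
    exact propext ⟨fun h => h.1, fun h => ⟨h, hy.2⟩⟩
  have hfin : a ≠ ∞ := ne_top_of_le_ne_top (measure_ne_top _ _) ha
  obtain ⟨t, -, ht⟩ := intermediate_value_Icc zero_le_one hg.continuous.continuousOn
    (show a.toReal ∈ Set.Icc (g 0) (g 1) from
      ⟨h0.trans_le ENNReal.toReal_nonneg, (ENNReal.toReal_mono (measure_ne_top _ _) ha).trans_eq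
        h1.symm⟩)
  exact ⟨E ∩ Set.Iic t, Set.inter_subset_left, hE.inter measurableSet_Iic,
    (ENNReal.toReal_eq_toReal_iff' (measure_ne_top _ _) hfin).1 ht⟩

/-- A measurable set can be split into measurable sets of prescribed measures. -/
theorem exists_partition_unitMeasure {ι : Type*} {s : Finset ι} (hs : s.Nonempty)
    (a : ι → ℝ≥0∞) {E : Set ℝ} (hE : MeasurableSet E) (h : unitMeasure E = ∑ i ∈ s, a i) :
    ∃ A : ι → Set ℝ, (∀ i ∈ s, MeasurableSet (A i) ∧ unitMeasure (A i) = a i ∧ A i ⊆ E) ∧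
      (∀ i ∈ s, ∀ j ∈ s, i ≠ j → Disjoint (A i) (A j)) ∧ ∀ t ∈ E, ∃ i ∈ s, t ∈ A i := by
  classical
  induction hs using Finset.Nonempty.cons_induction generalizing E with
  | singleton i =>
    rw [Finset.sum_singleton] at h
    refine ⟨fun _ => E, by simp [hE, h], ?_, fun t ht => ⟨i, by simp, ht⟩⟩
    simp only [Finset.mem_singleton]
    rintro _ rfl _ rfl hne
    exact absurd rfl hne
  | cons i s hi hs ih =>
    rw [Finset.sum_cons] at h
    obtain ⟨F, hFE, hF, hFa⟩ := exists_subset_unitMeasure_eq hE (h ▸ le_self_add : a i ≤ _)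
    have hdiff : unitMeasure (E \ F) = ∑ j ∈ s, a j := by
      rw [measure_sdiff hFE hF.nullMeasurableSet (measure_ne_top _ _), h, hFa,
        ENNReal.add_sub_cancel_left (hFa ▸ measure_ne_top _ _)]
    obtain ⟨A, hA, hd, hc⟩ := ih (hE.diff hF) hdiff
    have hne : ∀ j ∈ s, j ≠ i := fun j hj e => hi (e ▸ hj)
    have hFA : ∀ j ∈ s, Disjoint F (A j) := fun j hj =>
      Set.disjoint_of_subset_right (hA j hj).2.2 Set.disjoint_sdiff_right
    refine ⟨Function.update A i F, ?_, ?_, fun t ht => ?_⟩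
    · rw [Finset.forall_mem_cons]
      refine ⟨by simp [hF, hFa, hFE], fun j hj => ?_⟩
      rw [Function.update_of_ne (hne j hj)]
      exact ⟨(hA j hj).1, (hA j hj).2.1, (hA j hj).2.2.trans Set.sdiff_subset⟩
    · simp only [Finset.forall_mem_cons]
      refine ⟨⟨fun e => absurd rfl e, fun j hj _ => ?_⟩, fun j hj => ⟨fun _ => ?_, ?_⟩⟩
      · rw [Function.update_self, Function.update_of_ne (hne j hj)]
        exact hFA j hj
      · rw [Function.update_self, Function.update_of_ne (hne j hj)]
        exact (hFA j hj).symm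
      · intro l hl hjl
        rw [Function.update_of_ne (hne j hj), Function.update_of_ne (hne l hl)]
        exact hd j hj l hl hjl
    · by_cases htF : t ∈ F
      · exact ⟨i, by simp, by simpa using htF⟩
      · obtain ⟨j, hj, htj⟩ := hc t ⟨ht, htF⟩
        exact ⟨j, Finset.mem_cons_of_mem hj, by rwa [Function.update_of_ne (hne j hj)]⟩

end Splitting

/-! ### Existence of the measure `M` -/

namespace KGraph

variable {k : ℕ}

/-- Prolong a path from `v` to the start of `x` along `x` until its degree is at least `e_i`, then
truncate. -/
theorem StronglyConnected.noSources {Λ : KGraph k} (hΛ : Λ.StronglyConnected) (x : Λ.InfinitePath) :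
    Λ.NoSources := by
  intro v i
  obtain ⟨η, hr, hs⟩ := hΛ v (x.obj 0)
  have h : Λ.source η = Λ.range (x.pre (Pi.single i 1)) := hs.trans (x.range_seg _ _ _).symm
  have hle : Pi.single i 1 ≤ Λ.degree (Λ.comp η (x.pre (Pi.single i 1)) h) := by
    rw [Λ.degree_comp, x.degree_pre]
    exact le_add_self
  exact ⟨_, degree_take hle, by rw [range_take hle, Λ.range_comp, hr]⟩

section Existence

variable {Λ : KGraph k} [Λ.IsFinite]

/-- The prescribed measure `ρ(Λ)^{-d(η)} x^Λ_{s(η)}` of the cylinder set of `η`. -/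
noncomputable def cylinderMass (Λ : KGraph k) [Λ.IsFinite] (η : Λ.Path) : ℝ≥0∞ :=
  ENNReal.ofReal ((Λ.rhoPow (Λ.degree η))⁻¹ * Λ.perronVector (Λ.source η))

/-- This is `T_n x = ρ(Λ)^n x` divided by `ρ(Λ)^{d(η)+n}`: the prescribed masses are consistent
under extension. -/
theorem sum_pathsFrom_mass (hx : Λ.IsPerronFrobenius Λ.perronVector)
    (hρ : ∀ i, 0 < Λ.rho i) (η : Λ.Path) (n : Fin k → ℕ) :
    ∑ ν ∈ Λ.pathsFrom (Λ.source η) n,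
      ENNReal.ofReal ((Λ.rhoPow (Λ.degree η + n))⁻¹ * Λ.perronVector (Λ.source ν)) =
        Λ.cylinderMass η := by
  rw [← ENNReal.ofReal_sum_of_nonneg fun ν _ =>
    mul_nonneg (inv_nonneg.2 (rhoPow_nonneg _)) (hx.1 _).le, ← Finset.mul_sum,
    ← transfer_apply, hx.transfer_eq, cylinderMass, Pi.smul_apply, smul_eq_mul, rhoPow_add]
  congr 1
  have := (rhoPow_pos hρ n).ne'
  have := (rhoPow_pos hρ (Λ.degree η)).ne'
  field_simp

/-- `F` assigns to the paths of degree `(N, …, N)` the pieces of a measurable partition of `ℝ`,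
the piece of `η` having the measure prescribed for the cylinder set of `η`. -/
structure IsMassPartition (Λ : KGraph k) [Λ.IsFinite] (N : ℕ) (F : Λ.Path → Set ℝ) : Prop where
  measurableSet : ∀ η, (Λ.degree η = fun _ => N) → MeasurableSet (F η)
  mass : ∀ η, (Λ.degree η = fun _ => N) → unitMeasure (F η) = Λ.cylinderMass η
  eq_of_mem : ∀ η μ t, (Λ.degree η = fun _ => N) → (Λ.degree μ = fun _ => N) → t ∈ F η → t ∈ F μ →
    η = μ
  exists_mem : ∀ t, ∃ η, (Λ.degree η = fun _ => N) ∧ t ∈ F η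

theorem exists_isMassPartition_zero [Nonempty Λ.Vertex]
    (hx : Λ.IsPerronFrobenius Λ.perronVector) : ∃ F, Λ.IsMassPartition 0 F := by
  obtain ⟨A, hA, hd, hc⟩ := exists_partition_unitMeasure
    (Finset.univ_nonempty (α := Λ.Vertex)) (fun v => ENNReal.ofReal (Λ.perronVector v))
    MeasurableSet.univ (by
      rw [← ENNReal.ofReal_sum_of_nonneg fun v _ => (hx.1 v).le, hx.2.1]
      simp)
  refine ⟨fun η => A (Λ.source η), fun η _ => (hA _ (Finset.mem_univ _)).1, fun η hη => ?_,
    fun η μ t hη hμ h1 h2 => ?_, fun t => ?_⟩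
  · rw [(hA _ (Finset.mem_univ _)).2.1, cylinderMass, hη]
    change _ = ENNReal.ofReal ((Λ.rhoPow 0)⁻¹ * _)
    rw [rhoPow_zero, inv_one, one_mul]
  · rw [eq_one_of_degree_eq_zero hη, Λ.source_one] at h1
    rw [eq_one_of_degree_eq_zero hμ, Λ.source_one] at h2
    rw [eq_one_of_degree_eq_zero hη, eq_one_of_degree_eq_zero hμ]
    by_contra hne
    exact Set.disjoint_left.1 (hd _ (Finset.mem_univ _) _ (Finset.mem_univ _)
      fun e => hne (congrArg Λ.one e)) h1 h2
  · obtain ⟨v, -, hv⟩ := hc t (Set.mem_univ t)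
    exact ⟨Λ.one v, Λ.degree_one v, by rwa [Λ.source_one]⟩

theorem IsMassPartition.exists_refinement (hx : Λ.IsPerronFrobenius Λ.perronVector)
    (hρ : ∀ i, 0 < Λ.rho i) {N : ℕ} {F : Λ.Path → Set ℝ} (hF : Λ.IsMassPartition N F) :
    ∃ F', Λ.IsMassPartition (N + 1) F' ∧
      ∀ η, (Λ.degree η = fun _ => N + 1) → F' η ⊆ F (take η fun _ => N) := by
  -- An empty sum would contradict `T_n x = ρ(Λ)^n x > 0`.
  have hne : ∀ (v : Λ.Vertex) (n : Fin k → ℕ), (Λ.pathsFrom v n).Nonempty := by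
    intro v n
    by_contra h
    have := congrFun (hx.transfer_eq n) v
    rw [transfer_apply, Finset.not_nonempty_iff_eq_empty.1 h, Finset.sum_empty, Pi.smul_apply,
      smul_eq_mul] at this
    exact (mul_pos (rhoPow_pos hρ n) (hx.1 v)).ne this
  -- The piece of `η` is split among the continuations `ν` of degree `(1,…,1)`; paths of other
  -- degrees receive a default value so that `choose` applies.
  have key : ∀ η : Λ.Path, ∃ A : Λ.Path → Set ℝ, (Λ.degree η = fun _ => N) →
      (∀ ν ∈ Λ.pathsFrom (Λ.source η) (fun _ => 1), MeasurableSet (A ν) ∧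
        unitMeasure (A ν) = ENNReal.ofReal ((Λ.rhoPow (Λ.degree η + fun _ => 1))⁻¹ *
          Λ.perronVector (Λ.source ν)) ∧ A ν ⊆ F η) ∧
      (∀ i ∈ Λ.pathsFrom (Λ.source η) (fun _ => 1), ∀ j ∈ Λ.pathsFrom (Λ.source η) (fun _ => 1),
        i ≠ j → Disjoint (A i) (A j)) ∧
      ∀ t ∈ F η, ∃ i ∈ Λ.pathsFrom (Λ.source η) (fun _ => 1), t ∈ A i := by
    intro η
    by_cases h : Λ.degree η = fun _ => N
    · obtain ⟨A, hA⟩ := exists_partition_unitMeasure (hne (Λ.source η) fun _ => 1)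
        (fun ν => ENNReal.ofReal ((Λ.rhoPow (Λ.degree η + fun _ => 1))⁻¹ *
          Λ.perronVector (Λ.source ν))) (hF.measurableSet η h)
        ((hF.mass η h).trans (sum_pathsFrom_mass hx hρ η _).symm)
      exact ⟨A, fun _ => hA⟩
    · exact ⟨fun _ => ∅, fun h' => absurd h' h⟩
  choose A hA using key
  have hle : ∀ {η : Λ.Path}, (Λ.degree η = fun _ => N + 1) → (fun _ => N) ≤ Λ.degree η := by
    intro η hη
    rw [hη]
    exact fun _ => N.le_succ
  have htake : ∀ {η : Λ.Path}, (Λ.degree η = fun _ => N + 1) →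
      Λ.degree (take η fun _ => N) = fun _ => N := fun hη => degree_take (hle hη)
  have hdrop : ∀ {η : Λ.Path}, (Λ.degree η = fun _ => N + 1) →
      drop η (fun _ => N) ∈ Λ.pathsFrom (Λ.source (take η fun _ => N)) (fun _ => 1) := by
    intro η hη
    rw [mem_pathsFrom, degree_drop (hle hη), source_take (hle hη), hη]
    exact ⟨funext fun _ => by simp, rfl⟩
  have hsub : ∀ {η : Λ.Path}, (Λ.degree η = fun _ => N + 1) →
      A (take η fun _ => N) (drop η fun _ => N) ⊆ F (take η fun _ => N) := fun hη =>
    ((hA _ (htake hη)).1 _ (hdrop hη)).2.2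
  refine ⟨fun η => A (take η fun _ => N) (drop η fun _ => N), ⟨fun η hη => ?_, fun η hη => ?_,
    fun η μ t hη hμ h1 h2 => ?_, fun t => ?_⟩, fun η hη => hsub hη⟩
  · exact ((hA _ (htake hη)).1 _ (hdrop hη)).1
  · rw [((hA _ (htake hη)).1 _ (hdrop hη)).2.1, cylinderMass, htake hη, source_drop (hle hη), hη]
    rfl
  · have e1 : take η (fun _ => N) = take μ fun _ => N :=
      hF.eq_of_mem _ _ t (htake hη) (htake hμ) (hsub hη h1) (hsub hμ h2)
    have e2 : drop η (fun _ => N) = drop μ fun _ => N := by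
      by_contra hne
      have hη' := hdrop hη
      rw [e1] at h1 hη'
      exact Set.disjoint_left.1 ((hA _ (htake hμ)).2.1 _ hη' _ (hdrop hμ) hne) h1 h2
    rw [← comp_take_drop (hle hη), ← comp_take_drop (hle hμ)]
    simp only [e1, e2]
  · obtain ⟨η, hη, ht⟩ := hF.exists_mem t
    obtain ⟨ν, hν, htν⟩ := (hA η hη).2.2 t ht
    rw [mem_pathsFrom] at hν
    have hs : Λ.source η = Λ.range ν := hν.2.symm
    have htd := take_drop_comp η ν hs
    rw [hη] at htd
    refine ⟨Λ.comp η ν hs, ?_, ?_⟩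
    · rw [Λ.degree_comp, hη, hν.1]
      rfl
    · rwa [htd.1, htd.2]

theorem exists_seq_isMassPartition [Nonempty Λ.Vertex]
    (hx : Λ.IsPerronFrobenius Λ.perronVector) (hρ : ∀ i, 0 < Λ.rho i) :
    ∃ F : ℕ → Λ.Path → Set ℝ, (∀ N, Λ.IsMassPartition N (F N)) ∧
      ∀ N η, (Λ.degree η = fun _ => N + 1) → F (N + 1) η ⊆ F N (take η fun _ => N) := by
  obtain ⟨F₀, hF₀⟩ := exists_isMassPartition_zero hx
  choose step hstep using fun (N : ℕ) (F : {F // Λ.IsMassPartition N F}) =>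
    F.2.exists_refinement hx hρ
  let G : ∀ N, {F // Λ.IsMassPartition N F} := fun N =>
    Nat.rec ⟨F₀, hF₀⟩ (fun N F => ⟨step N F, (hstep N F).1⟩) N
  exact ⟨fun N => (G N).1, fun N => (G N).2, fun N => (hstep N (G N)).2⟩

/-- Nested partitions of `ℝ` indexed by the square paths give a map from `ℝ` to the infinite
paths. -/
theorem exists_map_to_infinitePath {F : ℕ → Λ.Path → Set ℝ} (hF : ∀ N, Λ.IsMassPartition N (F N))
    (hsub : ∀ N η, (Λ.degree η = fun _ => N + 1) → F (N + 1) η ⊆ F N (take η fun _ => N)) :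
    ∃ Φ : ℝ → Λ.InfinitePath, ∀ N η, (Λ.degree η = fun _ => N) → Φ ⁻¹' cylinder η = F N η := by
  choose p hpd hpm using fun (t : ℝ) (N : ℕ) => (hF N).exists_mem t
  have hstep : ∀ t N, take (p t (N + 1)) (fun _ => N) = p t N := by
    intro t N
    refine (hF N).eq_of_mem _ _ t (degree_take ?_) (hpd t N)
      (hsub N _ (hpd t (N + 1)) (hpm t (N + 1))) (hpm t N)
    rw [hpd]
    exact fun _ => N.le_succ
  have htake : ∀ t {M N}, M ≤ N → take (p t N) (fun _ => M) = p t M := by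
    intro t M N hMN
    induction N, hMN using Nat.le_induction with
    | base =>
      have := take_self (p t M)
      rwa [hpd] at this
    | succ N hMN ih =>
      rw [← ih, ← hstep t N, take_take (fun _ => hMN)]
      rw [hpd]
      exact fun _ => N.le_succ
  -- A prefix of arbitrary degree `n` is cut from the smallest square prefix containing it; `hgen`
  -- says that any larger square prefix gives the same result.
  let sup : (Fin k → ℕ) → ℕ := fun n => Finset.univ.sup n
  have hsup : ∀ n : Fin k → ℕ, n ≤ fun _ => sup n := fun n i =>
    Finset.le_sup (f := n) (Finset.mem_univ i)
  have hgen : ∀ t {n : Fin k → ℕ} {N : ℕ}, (n ≤ fun _ => N) →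
      take (p t N) n = take (p t (sup n)) n := by
    intro t n N hn
    rw [← htake t (Finset.sup_le fun i _ => hn i : sup n ≤ N), take_take (hsup n)]
    rw [hpd]
    exact fun _ => Finset.sup_le fun i _ => hn i
  refine ⟨fun t => InfinitePath.ofPrefixes (fun n => take (p t (sup n)) n)
    (fun n => degree_take (by rw [hpd]; exact hsup n)) (fun m n hmn => ?_), fun N η hη => ?_⟩
  · rw [take_take hmn (by rw [hpd]; exact hsup n), hgen t (hmn.trans (hsup n))]
  · ext t
    rw [Set.mem_preimage, mem_cylinder_iff_of_degree hη, InfinitePath.pre_ofPrefixes,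
      ← hgen t le_rfl, htake t le_rfl]
    constructor
    · rintro rfl
      exact hpm t N
    · exact fun ht => (hF N).eq_of_mem _ _ t (hpd t N) hη (hpm t N) ht

theorem sum_mass_extensions (hx : Λ.IsPerronFrobenius Λ.perronVector)
    (hρ : ∀ i, 0 < Λ.rho i) {η : Λ.Path} {n : Fin k → ℕ} (hn : Λ.degree η ≤ n) :
    ∑ μ ∈ (finite_degree_and n fun μ => take μ (Λ.degree η) = η).toFinset, Λ.cylinderMass μ =
      Λ.cylinderMass η := by
  have hfin := finite_degree_and (Λ := Λ) n fun μ => take μ (Λ.degree η) = η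
  have hmem : ∀ {μ}, μ ∈ hfin.toFinset ↔ Λ.degree μ = n ∧ take μ (Λ.degree η) = η :=
    Set.Finite.mem_toFinset _
  have hle : ∀ {μ}, μ ∈ hfin.toFinset → Λ.degree η ≤ Λ.degree μ := fun hμ => by
    rwa [(hmem.1 hμ).1]
  have hsrc : ∀ {ν}, ν ∈ Λ.pathsFrom (Λ.source η) (n - Λ.degree η) → Λ.source η = Λ.range ν :=
    fun hν => (mem_pathsFrom.1 hν).2.symm
  rw [← sum_pathsFrom_mass hx hρ η (n - Λ.degree η), add_tsub_cancel_of_le hn]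
  refine Finset.sum_bij' (s := hfin.toFinset) (fun μ _ => drop μ (Λ.degree η))
    (fun ν hν => Λ.comp η ν (hsrc hν)) (fun μ hμ => ?_) (fun ν hν => ?_)
    (fun μ hμ => ?_) (fun ν hν => ?_) (fun μ hμ => ?_)
  · rw [mem_pathsFrom, degree_drop (hle hμ), (hmem.1 hμ).1, ← source_take (hle hμ),
      (hmem.1 hμ).2]
    exact ⟨rfl, rfl⟩
  · refine hmem.2 ⟨?_, (take_drop_comp η ν (hsrc hν)).1⟩
    rw [Λ.degree_comp, (mem_pathsFrom.1 hν).1, add_tsub_cancel_of_le hn]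
  · have := comp_take_drop (hle hμ)
    simpa only [(hmem.1 hμ).2] using this
  · exact (take_drop_comp η ν (hsrc hν)).2
  · rw [cylinderMass, (hmem.1 hμ).1, source_drop (hle hμ)]

/-- The pushforward of Lebesgue measure has the right mass on square cylinders by construction, and
on the others by additivity over square extensions. -/
theorem exists_isPathMeasure [Nonempty Λ.Vertex] (hx : Λ.IsPerronFrobenius Λ.perronVector)
    (hρ : ∀ i, 0 < Λ.rho i) : ∃ M, Λ.IsPathMeasure M := by
  obtain ⟨F, hF, hsub⟩ := exists_seq_isMassPartition hx hρ
  obtain ⟨Φ, hΦ⟩ := exists_map_to_infinitePath hF hsub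
  have hmeas : Measurable Φ := by
    refine Measurable.of_le_map ((measurableSpace_eq_generateFrom Λ).le.trans
      (MeasurableSpace.generateFrom_le ?_))
    rintro _ ⟨η, N, hη, rfl⟩
    change MeasurableSet (Φ ⁻¹' cylinder η)
    rw [hΦ N η hη]
    exact (hF N).measurableSet η hη
  refine ⟨unitMeasure.map Φ, Measure.isProbabilityMeasure_map hmeas.aemeasurable, fun η => ?_⟩
  obtain ⟨N, hN⟩ := exists_degree_le_const (Λ.degree η)
  change _ = Λ.cylinderMass η
  have hfin := finite_degree_and (Λ := Λ) (fun _ => N) fun μ => take μ (Λ.degree η) = η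
  have hcyl : cylinder η = ⋃ μ ∈ hfin.toFinset, cylinder μ := by
    rw [cylinder_eq_iUnion hN]
    simp only [Set.Finite.mem_toFinset]
  have hmem : ∀ μ ∈ hfin.toFinset, Λ.degree μ = fun _ => N := fun μ hμ =>
    ((Set.Finite.mem_toFinset _).1 hμ).1
  rw [← sum_mass_extensions hx hρ hN, hcyl, measure_biUnion_finset
    (fun μ hμ ν hν hne => disjoint_cylinder ((hmem μ hμ).trans (hmem ν hν).symm) hne)
    fun μ _ => measurableSet_cylinder μ]
  refine Finset.sum_congr rfl fun μ hμ => ?_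
  rw [Measure.map_apply hmeas (measurableSet_cylinder μ), hΦ N μ (hmem μ hμ),
    (hF N).mass μ (hmem μ hμ)]

/-- A strongly connected graph without sources carries the measure `M`. -/
theorem isPathMeasure_pathMeasure [Nonempty Λ.Vertex] (hΛ : Λ.StronglyConnected)
    (hs : Λ.NoSources) : Λ.IsPathMeasure Λ.pathMeasure := by
  have hx := isPerronFrobenius_perronVector hΛ
  have h := exists_isPathMeasure hx (hx.rho_pos hs)
  rw [pathMeasure, dif_pos h]
  exact h.choose_spec

end Existence

end KGraph

/-! ### Assembly of the theorem -/

namespace KGraph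

variable {k : ℕ}

/-- With no infinite path, `L²` is zero and both sides agree. Otherwise an infinite path provides a
vertex and excludes sources, so `M` exists. -/
theorem waveletSpace_eq_span_isTranslate_of_stronglyConnected {Λ : KGraph k} [Λ.IsFinite]
    (hΛ : Λ.StronglyConnected) (q : ℕ) : Λ.waveletSpace q = Submodule.span ℂ
      {g | ∃ η : Λ.Path, (Λ.degree η = fun _ => q) ∧
        ∃ f ∈ Λ.waveletSpace 0, Λ.IsTranslate η f g} := by
  rcases isEmpty_or_nonempty Λ.InfinitePath with h | ⟨⟨x⟩⟩
  · have hzero : ∀ f : Λ.L2, f = 0 := fun f => Lp.ext (Eventually.of_forall fun x => h.elim x)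
    ext f
    simp only [hzero f, Submodule.zero_mem]
  · have : Nonempty Λ.Vertex := ⟨x.obj 0⟩
    have hs := hΛ.noSources x
    exact waveletSpace_eq_span_isTranslate (isPathMeasure_pathMeasure hΛ hs)
      ((isPerronFrobenius_perronVector hΛ).rho_pos hs) q

end KGraph

theorem mainTheorem6 {k : ℕ} (Λ : KGraph k) [Λ.IsFinite] (hΛ : Λ.StronglyConnected)
    (α : ℕ → ℝ) (hα_pos : ∀ q, 0 < α q) (hα_mono : StrictMono α)
    (hα_lim : Tendsto α atTop atTop) :
    -- the wavelet decomposition `L² = 𝒱_0 ⊕ ⨁_q 𝒲_q`, with `𝒲_q` obtained from `𝒲_0` by the `S_η`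
    IsHilbertSum ℂ (fun n => Λ.waveletSummand n) (fun n => (Λ.waveletSummand n).subtypeₗᵢ) ∧
    (∀ q, Λ.waveletSpace q = Submodule.span ℂ
      {g | ∃ η : Λ.Path, (Λ.degree η = fun _ => q) ∧
        ∃ f ∈ Λ.waveletSpace 0, Λ.IsTranslate η f g}) ∧
    -- `𝒱_0 = ℛ_0`, the orthogonal direct sum of `ℛ_0 ∩ ℛ_{-1}^⊥` and `ℛ_{-1}`
    Λ.scalingSpace 0 = Λ.boxSpace 0 ∧
    Λ.scalingSpace 0 = (Λ.boxSpace 0 ⊓ Λ.constSpaceᗮ) ⊔ Λ.constSpace ∧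
    (Λ.boxSpace 0 ⊓ Λ.constSpaceᗮ) ⟂ Λ.constSpace ∧
    -- `𝒲_q = ℛ_{q+1} ∩ ℛ_q^⊥`
    (∀ q, Λ.waveletSpace q = Λ.boxSpace (q + 1) ⊓ (Λ.boxSpace q)ᗮ) ∧
    -- the eigenspaces of `D`
    KGraph.eigenspace (Λ.dirac α) 0 = Λ.constSpace ∧
    KGraph.eigenspace (Λ.dirac α) (α 0) = Λ.boxSpace 0 ⊓ Λ.constSpaceᗮ ∧
    (∀ q, KGraph.eigenspace (Λ.dirac α) (α (q + 1)) = Λ.waveletSpace q) ∧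
    (∀ z : ℂ, z ≠ 0 → (∀ q, z ≠ α q) → KGraph.eigenspace (Λ.dirac α) z = ⊥) := by
  have hne : ∀ q, α q ≠ 0 := fun q => (hα_pos q).ne'
  refine ⟨KGraph.isHilbertSum_waveletSummand,
    KGraph.waveletSpace_eq_span_isTranslate_of_stronglyConnected hΛ,
    (KGraph.boxSpace_eq_scalingSpace 0).symm, ?_,
    (Submodule.isOrtho_orthogonal_left _).mono_left inf_le_right,
    KGraph.waveletSpace_eq_boxSpace, KGraph.eigenspace_dirac_zero hne,
    KGraph.eigenspace_dirac_apply hne hα_mono.injective 0, fun q => ?_,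
    fun z h0 hz => KGraph.eigenspace_dirac_eq_bot h0 hz⟩
  · rw [← KGraph.boxSpace_eq_scalingSpace, sup_comm, inf_comm,
      Submodule.sup_orthogonal_inf_of_hasOrthogonalProjection KGraph.constSpace_le_boxSpace_zero]
  · rw [KGraph.waveletSpace_eq_boxSpace]
    exact KGraph.eigenspace_dirac_apply hne hα_mono.injective (q + 1)
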